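/- Let $G$ be a connected compact simple Lie group of dimension $n>3$ with Lie algebra $\mathfrak g$ and Killing form $B$, let $h_{ij}=-B_{ij}$ be the bi-invariant metric on $G$ determined by $-B$, and let $D$ be its Levi-Civita connection, with curvature $R_{ijk}{}^{l}$, Ricci tensor $R_{ij}=R_{pij}{}^{p}$ and scalar curvature $R_h$. Indices are raised with $h$, and $|\omega|_h^2=\omega^{i_1\dots i_k}\omega_{i_1\dots i_k}$. Let $k\ge 3$, let $P$ be an $\mathrm{Ad}(G)$-invariant homogeneous polynomial of degree $k$ on $\mathfrak g$ that is harmonic for the Laplacian of $h$ on $\mathfrak g$, and let $\omega\in S^k(\mathfrak g^*)$ be its complete polarization, so that $\omega$ is symmetric and $P(x)=\omega(x,\dots,x)$; regard $\omega$ as a left-invariant tensor field on $G$. For a symmetric $\omega$ put $$(\omega\wedge\omega)_{ijkl}=\omega_{k[i}{}^{p_1\dots p_{k-2}}\omega_{j]lp_1\dots p_{k-2}}-\omega_{l[i}{}^{p_1\dots p_{k-2}}\omega_{j]kp_1\dots p_{k-2}},\qquad \mathrm{Ric}(\omega\wedge\omega)_{ij}=(\omega\wedge\omega)_{pij}{}^{p},$$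 $$T^{+}(\omega)_{ij}=\mathrm{Ric}(\omega\wedge\omega)_{ij}-\tfrac12|\omega|_h^2h_{ij},\qquad T^{-}(\omega)_{ij}=\mathrm{Ric}(\omega\wedge\omega)_{ij}+\tfrac1{2k}|\omega|_h^2h_{ij}.$$ Then: 1. The pair $(h,\omega)$ solves the coupled Einstein equations: $h$ is a smooth metric; $\omega$ is a smooth, symmetric, trace-free tensor field; the one-forms $\omega^{p_1\dots p_k}\mathcal K(\omega)_{ip_1\dots p_k}$, $\omega^{p_1\dots p_k}\mathcal L(\omega)_{ip_1\dots p_k}$ and $\omega_i{}^{p_1\dots p_{k-1}}D^q\omega_{qp_1\dots p_{k-1}}$ vanish, where $\mathcal K(\omega)$ and $\mathcal L(\omega)$ are the trace-free parts of $D_{[i}\omega_{j]i_1\dots i_{k-1}}$ and $D_{(i_1}\omega_{i_2\dots i_{k+1})}$; and for all real constants $a,b$ there is a real constant $\kappa$ such that on $G$ $$R_{ij}-\tfrac12R_hh_{ij}+\tfrac{n-2}{2n}\kappa h_{ij}=a\,T^{+}(\omega)_{ij}+b\,T^{-}(\omega)_{ij}.$$ In particular (taking $b=0$), $R_{ij}-\tfrac12R_hh_{ij}+\tfrac{n-2}{2n}\kappa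 h_{ij}=a\left(\mathrm{Ric}(\omega\wedge\omega)_{ij}-\tfrac12|\omega|_h^2h_{ij}\right)$. 2. $\omega$ is parallel: $D\omega=0$. 3. There is a constant $c$ with $c=|\omega|_h^2/n$ at every point of $G$ and $\omega_i{}^{p_1\dots p_{k-1}}\omega_{jp_1\dots p_{k-1}}=c\,h_{ij}$. -/

import Mathlib

open scoped Manifold ContDiff

noncomputable section

namespace CoupledEinstein

/-! ### Tensor algebra on a vector space with a nondegenerate symmetric bilinear form

A covariant tensor of rank `m` on `V` is used through its values `(Fin m → V) → ℝ`; all indices are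
raised with the inverse of the Gram matrix of `h`. -/

section Algebra

variable {V : Type*} [AddCommGroup V] [Module ℝ V]

/-- Insertion of `u` in the first slot: `α_{u i₁ … iₘ}`. -/
def ins {m : ℕ} (u : V) (α : (Fin (m + 1) → V) → ℝ) : (Fin m → V) → ℝ :=
  fun w => α (Matrix.vecCons u w)

/-- The complete symmetrization `α_{(i₁ … iₘ)}`. -/
def symmetrize {m : ℕ} (α : (Fin m → V) → ℝ) : (Fin m → V) → ℝ :=
  fun w => ((m.factorial : ℝ))⁻¹ * ∑ s : Equiv.Perm (Fin m), α (fun i => w (s i))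

/-- `η` is a completely symmetric tensor and `P(x) = η(x, …, x)`: that is, `P` is a homogeneous
polynomial of degree `k` and `η` is its (unique) complete polarization. -/
structure IsPolarization {k : ℕ} (η : MultilinearMap ℝ (fun _ : Fin k => V) ℝ) (P : V → ℝ) :
    Prop where
  symm : ∀ (s : Equiv.Perm (Fin k)) (w : Fin k → V), η (fun i => w (s i)) = η w
  diag : ∀ x, P x = η (fun _ => x)

variable [Module.Finite ℝ V] (h : LinearMap.BilinForm ℝ V)

/-- The components `h^{pq}` of the dual bivector of `h`, in the basis `Module.finBasis ℝ V`. -/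
def dualMetric : Matrix (Fin (Module.finrank ℝ V)) (Fin (Module.finrank ℝ V)) ℝ :=
  (LinearMap.BilinForm.toMatrix (Module.finBasis ℝ V) h)⁻¹

/-- The contraction `h^{pq} f_{pq}`. -/
def contract (f : V → V → ℝ) : ℝ :=
  ∑ p, ∑ q, dualMetric h p q * f (Module.finBasis ℝ V p) (Module.finBasis ℝ V q)

/-- The complete contraction
`⟨α, β⟩ = h^{p₁q₁} ⋯ h^{pₘqₘ} α_{p₁…pₘ} β_{q₁…qₘ}`. -/
def pairing {m : ℕ} (α β : (Fin m → V) → ℝ) : ℝ :=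
  ∑ p : Fin m → Fin (Module.finrank ℝ V), ∑ q : Fin m → Fin (Module.finrank ℝ V),
    (∏ s, dualMetric h (p s) (q s)) *
      (α (fun s => Module.finBasis ℝ V (p s)) * β (fun s => Module.finBasis ℝ V (q s)))

/-- The squared norm `|α|²_h`. -/
def normSq {m : ℕ} (α : (Fin m → V) → ℝ) : ℝ := pairing h α α

/-- The trace over the first two indices. -/
def trace {m : ℕ} (α : (Fin (m + 2) → V) → ℝ) : (Fin m → V) → ℝ :=
  fun w => contract h (fun u v => ins v (ins u α) w)

/-- The contraction `α_i^{p₁ … pₘ} β_{j p₁ … pₘ}`. -/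
def ricciContraction {m : ℕ} (α β : (Fin (m + 1) → V) → ℝ) (i j : V) : ℝ :=
  pairing h (ins i α) (ins j β)

/-- The product
`(α ∧ β)_{ijkl} = α_{k[i}^{p₁…pₘ} β_{j]lp₁…pₘ} - α_{l[i}^{p₁…pₘ} β_{j]kp₁…pₘ}`,
where brackets denote antisymmetrization with the factor `1/2`. -/
def kulkarniNomizu {m : ℕ} (α β : (Fin (m + 2) → V) → ℝ) (i j k l : V) : ℝ :=
  let c : V → V → V → V → ℝ := fun a b c d => pairing h (ins b (ins a α)) (ins d (ins c β))
  (1 / 2) * (c k i j l - c k j i l) - (1 / 2) * (c l i j k - c l j i k)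

/-- The Ricci trace `Y_{pij}^p` of a rank four tensor `Y_{ijkl}`. -/
def ricciTrace (Y : V → V → V → V → ℝ) (i j : V) : ℝ := contract h (fun p q => Y p i j q)

/-- `T⁺(η) = Ric(η ∧ η) - ½ |η|² h`. -/
def stressPlus {m : ℕ} (η : (Fin (m + 2) → V) → ℝ) (i j : V) : ℝ :=
  ricciTrace h (kulkarniNomizu h η η) i j - (1 / 2) * normSq h η * h i j

/-- `T⁻(η) = Ric(η ∧ η) + (1 / (2 k)) |η|² h`, for `η` of rank `k = m + 2`. -/
def stressMinus {m : ℕ} (η : (Fin (m + 2) → V) → ℝ) (i j : V) : ℝ :=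
  ricciTrace h (kulkarniNomizu h η η) i j
    + (1 / (2 * ((m + 2 : ℕ) : ℝ))) * normSq h η * h i j

/-! In the following, `Dη` is the covariant derivative of a trace-free symmetric tensor `η` of rank
`k = m + 1` at one point; its first argument is the direction of differentiation. -/

/-- The divergence `D^p η_{p i₁ … iₘ}`. -/
def divergence {m : ℕ} (Dη : V → (Fin (m + 1) → V) → ℝ) : (Fin m → V) → ℝ :=
  fun w => contract h (fun p q => ins q (Dη p) w)

/-- The trace-free part of `D_{[i}η_{j]i₁…iₘ}`, which is
`D_{[i}η_{j]i₁…iₘ} - (n+k-3)⁻¹ ∑ₛ h_{iₛ[i} div(η)_{j]i₁…îₛ…iₘ}` with `k = m + 1`; the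
first argument is `i`, and the arguments of the value are `j, i₁, …, iₘ`. -/
def codazziPart {m : ℕ} (Dη : V → (Fin (m + 1) → V) → ℝ) (i : V) : (Fin (m + 1) → V) → ℝ :=
  fun w =>
    let j : V := w 0
    let r : Fin m → V := Matrix.vecTail w
    (1 / 2) * (Dη i (Matrix.vecCons j r) - Dη j (Matrix.vecCons i r))
      - ((Module.finrank ℝ V : ℝ) + ((m + 1 : ℕ) : ℝ) - 3)⁻¹ *
        ∑ s : Fin m, (1 / 2) *
          (h (r s) i * divergence h Dη (Function.update r s j)
            - h (r s) j * divergence h Dη (Function.update r s i))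

/-- The trace-free part of `D_{(i₁}η_{i₂…i_{k+1})}`, which is
`D_{(i₁}η_{i₂…i_{k+1})} - (k / (n+2(k-1))) h_{(i₁i₂} div(η)_{i₃…i_{k+1})}` with `k = m + 1`. -/
def killingPart {m : ℕ} (Dη : V → (Fin (m + 1) → V) → ℝ) : (Fin (m + 2) → V) → ℝ :=
  fun w =>
    symmetrize (fun v : Fin (m + 2) → V => Dη (v 0) (Matrix.vecTail v)) w
      - (((m + 1 : ℕ) : ℝ) / ((Module.finrank ℝ V : ℝ) + 2 * (((m + 1 : ℕ) : ℝ) - 1))) *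
        symmetrize (fun v : Fin (m + 2) → V =>
          h (v 0) (v 1) * divergence h Dη (Matrix.vecTail (Matrix.vecTail v))) w

/-- The one-form `η^{p₁…p_k} K(η)_{ip₁…p_k}`, with `K(η)` the trace-free part of `D_{[i}η_{j]…}`. -/
def codazziForm {m : ℕ} (η : (Fin (m + 1) → V) → ℝ) (Dη : V → (Fin (m + 1) → V) → ℝ) (i : V) : ℝ :=
  pairing h η (codazziPart h Dη i)

/-- The one-form `η^{p₁…p_k} L(η)_{ip₁…p_k}`, with `L(η)` the trace-free part of `D_{(i}η_{…)}`. -/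
def conformalKillingForm {m : ℕ} (η : (Fin (m + 1) → V) → ℝ) (Dη : V → (Fin (m + 1) → V) → ℝ) (i : V) :
    ℝ :=
  pairing h η (ins i (killingPart h Dη))

/-- The one-form `η_i^{p₁…p_{k-1}} div(η)_{p₁…p_{k-1}}`. -/
def divergenceForm {m : ℕ} (η : (Fin (m + 1) → V) → ℝ) (Dη : V → (Fin (m + 1) → V) → ℝ) (i : V) :
    ℝ :=
  pairing h (ins i η) (divergence h Dη)

/-- The Laplacian `h^{pq} ∂_p ∂_q P` of a function on `V`, for the constant metric `h`. -/
def laplacian (P : V → ℝ) (x : V) : ℝ :=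
  contract h (fun u v => lineDeriv ℝ (fun y => lineDeriv ℝ P y v) x u)

end Algebra

/-! ### Pseudo-Riemannian geometry -/

section Manifold

variable {E : Type*} [NormedAddCommGroup E] [NormedSpace ℝ E]
  {H : Type*} [TopologicalSpace H] {I : ModelWithCorners ℝ E H}
  {M : Type*} [TopologicalSpace M] [ChartedSpace H M]

instance finite_tangentSpace [FiniteDimensional ℝ E] (x : M) : Module.Finite ℝ (TangentSpace I x) :=
  inferInstanceAs (Module.Finite ℝ E)

/-- A smooth pseudo-Riemannian metric. -/
structure IsMetric [IsManifold I ∞ M] (h : ∀ x : M, LinearMap.BilinForm ℝ (TangentSpace I x)) :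
    Prop where
  symm : ∀ x u v, h x u v = h x v u
  nondegenerate : ∀ x, (h x).Nondegenerate
  smooth : ∀ X Y : ∀ x : M, TangentSpace I x,
    ContMDiff I I.tangent ∞ (fun x => (X x : TangentBundle I M)) →
    ContMDiff I I.tangent ∞ (fun x => (Y x : TangentBundle I M)) →
    ContMDiff I 𝓘(ℝ, ℝ) ∞ (fun x => h x (X x) (Y x))

/-- A smooth, completely symmetric, trace-free covariant tensor field of rank `m + 2`. -/
structure IsTraceFreeSymmetricTensor [FiniteDimensional ℝ E] [IsManifold I ∞ M] {m : ℕ}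
    (h : ∀ x : M, LinearMap.BilinForm ℝ (TangentSpace I x))
    (η : ∀ x : M, MultilinearMap ℝ (fun _ : Fin (m + 2) => TangentSpace I x) ℝ) : Prop where
  symm : ∀ x (s : Equiv.Perm (Fin (m + 2))) (w : Fin (m + 2) → TangentSpace I x),
    η x (fun i => w (s i)) = η x w
  traceFree : ∀ x w, trace (h x) (η x) w = 0
  smooth : ∀ X : Fin (m + 2) → ∀ x : M, TangentSpace I x,
    (∀ i, ContMDiff I I.tangent ∞ (fun x => (X i x : TangentBundle I M))) →
    ContMDiff I 𝓘(ℝ, ℝ) ∞ (fun x => η x (fun i => X i x))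

variable [IsManifold I ∞ M]

/-- `D` is the Levi-Civita connection of `h`: it is torsion-free and `Dh = 0`. Here `D Y x v` is the
derivative of the vector field `Y` at `x` in the direction `v`. -/
structure IsLeviCivita [FiniteDimensional ℝ E] [CompleteSpace E]
    (h : ∀ x : M, LinearMap.BilinForm ℝ (TangentSpace I x))
    (D : CovariantDerivative I E (TangentSpace I : M → Type _)) : Prop where
  torsion_free : D.torsion = 0
  metric : ∀ (x : M) (v : TangentSpace I x) (Y Z : ∀ x : M, TangentSpace I x),
    MDifferentiableAt I I.tangent (fun y => (Y y : TangentBundle I M)) x →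
    MDifferentiableAt I I.tangent (fun y => (Z y : TangentBundle I M)) x →
    mvfderiv I (fun y => h y (Y y) (Z y)) x v = h x (D Y x v) (Z x) + h x (Y x) (D Z x v)

/-- The curvature `R(u, v)w = D_u D_v w - D_v D_u w - D_{[u,v]} w` of a connection on the tangent
bundle, computed on local extensions of `u`, `v`, `w` to smooth vector fields near `x`. -/
def curvature (D : CovariantDerivative I E (TangentSpace I : M → Type _)) (x : M)
    (u v w : TangentSpace I x) : TangentSpace I x :=
  let U : ∀ y : M, TangentSpace I y := FiberBundle.extend E u
  let V : ∀ y : M, TangentSpace I y := FiberBundle.extend E v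
  let W : ∀ y : M, TangentSpace I y := FiberBundle.extend E w
  D (fun y => D W y (V y)) x u - D (fun y => D W y (U y)) x v
    - D W x (VectorField.mlieBracket I U V x)

/-- The covariant derivative of a tensor field at `x`,
`(D_v η)(w₁, …, w_k) = v(η(w₁, …, w_k)) - ∑ᵢ η(w₁, …, D_v wᵢ, …, w_k)`, computed on local
extensions of the `wᵢ` to smooth vector fields near `x`. -/
def covDeriv {k : ℕ} (D : CovariantDerivative I E (TangentSpace I : M → Type _))
    (η : ∀ x : M, MultilinearMap ℝ (fun _ : Fin k => TangentSpace I x) ℝ) (x : M)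
    (v : TangentSpace I x) (w : Fin k → TangentSpace I x) : ℝ :=
  let W : Fin k → ∀ y : M, TangentSpace I y := fun i => FiberBundle.extend E (w i)
  mvfderiv I (fun y => η y (fun i => W i y)) x v
    - ∑ i, η x (Function.update w i (D (W i) x v))

variable [FiniteDimensional ℝ E]

/-- The Ricci tensor `R_{ij} = R_{pij}^p`. -/
def ricci (h : ∀ x : M, LinearMap.BilinForm ℝ (TangentSpace I x))
    (D : CovariantDerivative I E (TangentSpace I : M → Type _)) (x : M)
    (i j : TangentSpace I x) : ℝ :=
  ricciTrace (h x) (fun a b c d => h x (curvature D x a b c) d) i j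

/-- The scalar curvature. -/
def scalarCurvature (h : ∀ x : M, LinearMap.BilinForm ℝ (TangentSpace I x))
    (D : CovariantDerivative I E (TangentSpace I : M → Type _)) (x : M) : ℝ :=
  contract (h x) (ricci h D x)

/-- The pair `(h, η)`, of a metric `h` with Levi-Civita connection `D` and a trace-free symmetric
tensor `η` of rank `k = m + 2`, solves the coupled Einstein equations with coupling constants
`a` and `b`:
`R_{ij} - ½ R h_{ij} + ((n-2)/(2n)) κ h_{ij} = a T⁺(η)_{ij} + b T⁻(η)_{ij}` for a constant `κ`.
The vanishing one-forms are the conditions on `η` under which these equations are posed. -/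
structure SolvesCoupledEinstein {m : ℕ}
    (h : ∀ x : M, LinearMap.BilinForm ℝ (TangentSpace I x))
    (D : CovariantDerivative I E (TangentSpace I : M → Type _))
    (η : ∀ x : M, MultilinearMap ℝ (fun _ : Fin (m + 2) => TangentSpace I x) ℝ) (a b : ℝ) :
    Prop where
  isMetric : IsMetric h
  isTraceFreeSymmetric : IsTraceFreeSymmetricTensor h η
  codazzi : ∀ x i, codazziForm (h x) (η x) (covDeriv D η x) i = 0
  killing : ∀ x i, conformalKillingForm (h x) (η x) (covDeriv D η x) i = 0
  divergence : ∀ x i, divergenceForm (h x) (η x) (covDeriv D η x) i = 0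
  einstein : ∃ κ : ℝ, ∀ (x : M) (i j : TangentSpace I x),
    ricci h D x i j - (1 / 2) * scalarCurvature h D x * h x i j
        + (((Module.finrank ℝ E : ℝ) - 2) / (2 * (Module.finrank ℝ E : ℝ))) * κ * h x i j
      = a * stressPlus (h x) (η x) i j + b * stressMinus (h x) (η x) i j

end Manifold

/-! ### Invariant tensors on Lie groups -/

section LieGroup

instance leInfty_minSmoothness : ENat.LEInfty (minSmoothness ℝ 3) := by
  rw [minSmoothness_of_isRCLikeNormedField]
  infer_instance

variable {E : Type*} [NormedAddCommGroup E] [NormedSpace ℝ E]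
  {H : Type*} [TopologicalSpace H] {I : ModelWithCorners ℝ E H}
  {G : Type*} [TopologicalSpace G] [ChartedSpace H G] [Group G]

/-- The differential at `g` of the left translation by `g⁻¹`, as a map `T_g G → T_1 G`. -/
def toLieAlgebra (g : G) : TangentSpace I g →ₗ[ℝ] GroupLieAlgebra I G :=
  (mfderiv I I (fun y : G => g⁻¹ * y) g : E →L[ℝ] E).toLinearMap

/-- The adjoint action of `g`: the differential at `1` of `y ↦ g y g⁻¹`. -/
def adjointAction (g : G) : GroupLieAlgebra I G →ₗ[ℝ] GroupLieAlgebra I G :=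
  (mfderiv I I (fun y : G => g * y * g⁻¹) 1 : E →L[ℝ] E).toLinearMap

/-- The left-invariant tensor field on `G` with value `η` at the identity. -/
def invariantTensor {k : ℕ} (η : MultilinearMap ℝ (fun _ : Fin k => GroupLieAlgebra I G) ℝ)
    (g : G) : MultilinearMap ℝ (fun _ : Fin k => TangentSpace I g) ℝ :=
  η.compLinearMap (fun _ => toLieAlgebra g)

variable (I G) in
/-- The negative of the Killing form of the Lie algebra of `G`. -/
def negKilling [CompleteSpace E] [LieGroup I ∞ G] :
    LinearMap.BilinForm ℝ (GroupLieAlgebra I G) :=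
  -killingForm ℝ (GroupLieAlgebra I G)

variable (I G) in
/-- The invariant metric on `G` whose value at the identity is the negative of the Killing form. -/
def killingMetric [CompleteSpace E] [LieGroup I ∞ G] (g : G) :
    LinearMap.BilinForm ℝ (TangentSpace I g) :=
  (negKilling I G).compl₁₂ (toLieAlgebra g) (toLieAlgebra g)

end LieGroup

end CoupledEinstein

end

open scoped Manifold ContDiff

noncomputable section

namespace CoupledEinstein

/-! ### Contractions in an orthonormal basis -/

/-! Everything reduces to invariant theory on the Lie algebra: both sides of the Einstein equation
are constant multiples of `h`, and `κ` is the constant that balances them.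

Definiteness. Haar averaging gives an inner product invariant under the adjoint action. For it each
`ad x` is skew, so `-B(x, x)` is the sum of the squares `|[x, e i]|²`. This vanishes only for
central `x`, and a simple algebra has no centre (`neg_killingForm_pos`, `negKilling_pos`).

Parallelism. The Levi-Civita connection is half the bracket on left-invariant fields
(`IsLeviCivita.toLieAlgebra_invariant`); on a general field the derivative of its components is
added (`IsLeviCivita.toLieAlgebra_connection`). The differential of `Ad` at the identity is the
bracket (`mfderiv_adjointOrbit`), so invariance of `P`, differentiated and polarized, says that
inserting `[x, ·]` into the slots of `ω` one at a time and summing gives zero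
(`sum_map_update_lie`). Up to the factor `-1/2`, that sum is the covariant derivative of `ω`
(`IsLeviCivita.covDeriv_invariantTensor`), so `ω` is parallel and the three one-forms vanish.

Curvature. From the connection one gets `R(u, v)w = -(1/4)[[u, v], w]`. Its Ricci trace is a trace
of `ad ∘ ad`, hence `Ric = h/4` and the scalar curvature is `n/4`.

Stress tensors. Harmonicity of `P` makes `ω` trace-free (`trace_eq_zero_of_harmonic`), which
collapses `Ric(ω ∧ ω)` to the contraction of two copies of `ω` over all but one index
(`IsOrthonormalBasis.ricciTrace_kulkarniNomizu`). That contraction is a symmetric invariant form, so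
by a Schur argument for simple algebras it is `c h` (`IsOrthonormalBasis.exists_eq_mul`), and
tracing gives `|ω|² = n c`. -/

theorem map_eq_sum_repr {V : Type*} [AddCommGroup V] [Module ℝ V] {κ : Type*} [Fintype κ] {m : ℕ}
    (b : Module.Basis κ ℝ V)
    (α : MultilinearMap ℝ (fun _ : Fin m => V) ℝ) (w : Fin m → V) :
    α w = ∑ p : Fin m → κ, (∏ s, b.repr (w s) (p s)) * α (fun s => b (p s)) := by
  classical
  conv_lhs => rw [show w = fun s => ∑ p, b.repr (w s) p • b p from
    funext fun s => (b.sum_repr (w s)).symm]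
  rw [MultilinearMap.map_sum]
  simp only [MultilinearMap.map_smul_univ, smul_eq_mul]

section Contractions

variable {V : Type*} [AddCommGroup V] [Module ℝ V]
  {ι : Type*} [Fintype ι] [DecidableEq ι] {h : LinearMap.BilinForm ℝ V}

/-- A basis is orthonormal for a bilinear form. -/
def IsOrthonormalBasis (h : LinearMap.BilinForm ℝ V) (e : Module.Basis ι ℝ V) : Prop :=
  ∀ i j, h (e i) (e j) = if i = j then 1 else 0

theorem IsOrthonormalBasis.apply_eq_sum {e : Module.Basis ι ℝ V} (he : IsOrthonormalBasis h e)
    (u v : V) : h u v = ∑ i, e.repr u i * e.repr v i := by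
  conv_lhs => rw [← e.sum_repr u, ← e.sum_repr v]
  simp only [map_sum, map_smul, LinearMap.sum_apply, LinearMap.smul_apply, smul_eq_mul, he _ _]
  simp [mul_comm]

theorem IsOrthonormalBasis.apply_basis {e : Module.Basis ι ℝ V} (he : IsOrthonormalBasis h e)
    (u : V) (i : ι) : h u (e i) = e.repr u i := by
  rw [he.apply_eq_sum]
  simp [Finsupp.single_apply]

variable [Module.Finite ℝ V]

/-- If `A` expresses the reference basis in terms of `e`, the Gram matrix is `Aᵀ A`, with inverse
`A⁻¹ (A⁻¹)ᵀ`. This turns contractions written in `Module.finBasis` into diagonal sums over any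
orthonormal basis. -/
theorem IsOrthonormalBasis.dualMetric_apply {e : Module.Basis ι ℝ V}
    (he : IsOrthonormalBasis h e) (p q : Fin (Module.finrank ℝ V)) :
    dualMetric h p q
      = ∑ i, (Module.finBasis ℝ V).repr (e i) p * (Module.finBasis ℝ V).repr (e i) q := by
  set b := Module.finBasis ℝ V
  have hG : LinearMap.BilinForm.toMatrix b h = (e.toMatrix b).transpose * e.toMatrix b := by
    ext i j
    rw [LinearMap.BilinForm.toMatrix_apply, he.apply_eq_sum]
    simp [Matrix.mul_apply, Module.Basis.toMatrix_apply]
  have h1 : e.toMatrix b * b.toMatrix e = 1 := e.toMatrix_mul_toMatrix_flip b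
  have hinv : dualMetric h = b.toMatrix e * (b.toMatrix e).transpose := by
    refine Matrix.inv_eq_right_inv ?_
    change LinearMap.BilinForm.toMatrix b h * _ = 1
    rw [hG, Matrix.mul_assoc, ← Matrix.mul_assoc (e.toMatrix b), h1, Matrix.one_mul,
      ← Matrix.transpose_mul]
    rw [b.toMatrix_mul_toMatrix_flip e, Matrix.transpose_one]
  rw [hinv]
  simp [Matrix.mul_apply, Module.Basis.toMatrix_apply]

/-- `contract` only samples its argument on one fixed basis, so bilinearity is what allows the
change of basis. This is why integrands are bundled as bilinear maps before each use. -/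
theorem IsOrthonormalBasis.contract_eq {e : Module.Basis ι ℝ V} (he : IsOrthonormalBasis h e)
    (f : V →ₗ[ℝ] V →ₗ[ℝ] ℝ) : contract h (fun u v => f u v) = ∑ i, f (e i) (e i) := by
  set b := Module.finBasis ℝ V
  have hexp : ∀ i, f (e i) (e i) = ∑ p, ∑ q, b.repr (e i) p * b.repr (e i) q * f (b p) (b q) := by
    intro i
    conv_lhs => rw [← b.sum_repr (e i)]
    simp only [map_sum, map_smul, LinearMap.sum_apply, LinearMap.smul_apply, smul_eq_mul,
      Finset.mul_sum]
    rw [Finset.sum_comm]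
    refine Finset.sum_congr rfl fun p _ => Finset.sum_congr rfl fun q _ => by ring
  simp only [contract, he.dualMetric_apply, hexp, Finset.sum_mul]
  conv_rhs => rw [Finset.sum_comm]
  refine Finset.sum_congr rfl fun p _ => ?_
  rw [Finset.sum_comm]

theorem IsOrthonormalBasis.pairing_eq {e : Module.Basis ι ℝ V} (he : IsOrthonormalBasis h e)
    {m : ℕ} (α β : MultilinearMap ℝ (fun _ : Fin m => V) ℝ) :
    pairing h α β = ∑ p : Fin m → ι, α (fun s => e (p s)) * β (fun s => e (p s)) := by
  classical
  set b := Module.finBasis ℝ V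
  have hprod : ∀ p q : Fin m → Fin (Module.finrank ℝ V), ∏ s, dualMetric h (p s) (q s)
      = ∑ i : Fin m → ι, (∏ s, b.repr (e (i s)) (p s)) * ∏ s, b.repr (e (i s)) (q s) := by
    intro p q
    simp only [he.dualMetric_apply]
    rw [Finset.prod_univ_sum]
    simp [Finset.prod_mul_distrib, b]
  simp only [pairing, hprod, Finset.sum_mul]
  have hexp : ∀ i : Fin m → ι, α (fun s => e (i s)) * β (fun s => e (i s))
      = ∑ p : Fin m → Fin (Module.finrank ℝ V), ∑ q : Fin m → Fin (Module.finrank ℝ V),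
        (∏ s, b.repr (e (i s)) (p s)) * (∏ s, b.repr (e (i s)) (q s)) *
          (α (fun s => b (p s)) * β (fun s => b (q s))) := by
    intro i
    rw [map_eq_sum_repr b α, map_eq_sum_repr b β, Finset.sum_mul_sum]
    refine Finset.sum_congr rfl fun p _ => Finset.sum_congr rfl fun q _ => by ring
  simp only [hexp]
  conv_rhs => rw [Finset.sum_comm]
  refine Finset.sum_congr rfl fun p _ => ?_
  rw [Finset.sum_comm]

end Contractions

/-! ### Calculus of multilinear maps -/

section Multilinear

variable {F : Type*} [NormedAddCommGroup F] [NormedSpace ℝ F] [FiniteDimensional ℝ F] {k : ℕ}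

/-- A multilinear map on a finite-dimensional space, as a continuous multilinear map. -/
def toContinuousMultilinear (η : MultilinearMap ℝ (fun _ : Fin k => F) ℝ) :
    ContinuousMultilinearMap ℝ (fun _ : Fin k => F) ℝ where
  toMultilinearMap := η
  cont := by
    have hη : ⇑η = fun w => ∑ p : Fin k → Fin (Module.finrank ℝ F),
        (∏ s, (Module.finBasis ℝ F).repr (w s) (p s)) *
          η (fun s => Module.finBasis ℝ F (p s)) :=
      funext fun w => map_eq_sum_repr (Module.finBasis ℝ F) η w
    change Continuous η
    rw [hη]
    refine continuous_finsetSum _ fun p _ => Continuous.mul ?_ continuous_const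
    refine continuous_finsetProd _ fun s _ => ?_
    have hc : Continuous ((Module.finBasis ℝ F).coord (p s)) :=
      LinearMap.continuous_of_finiteDimensional _
    exact hc.comp (continuous_apply s)

@[simp]
theorem toContinuousMultilinear_apply (η : MultilinearMap ℝ (fun _ : Fin k => F) ℝ)
    (w : Fin k → F) : toContinuousMultilinear η w = η w := rfl

end Multilinear

/-! ### Polarization: symmetric multilinear maps and their diagonals -/

section Polarization

variable {V : Type*} [AddCommGroup V] [Module ℝ V]

theorem hasDerivAt_multilinear {k : ℕ} (η : MultilinearMap ℝ (fun _ : Fin k => V) ℝ)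
    (a b : Fin k → V) :
    HasDerivAt (fun t : ℝ => η (fun i => a i + t • b i))
      (∑ i, η (Function.update a i (b i))) 0 := by
  -- `V` carries no topology here. The curve is factored through a multilinear map on copies of `ℝ ×
  -- ℝ`, where the normed calculus applies.
  let ξ : MultilinearMap ℝ (fun _ : Fin k => ℝ × ℝ) ℝ :=
    η.compLinearMap fun i => (LinearMap.toSpanSingleton ℝ V (a i)).coprod
      (LinearMap.toSpanSingleton ℝ V (b i))
  have hξ : ∀ c : Fin k → ℝ × ℝ, ξ c = η (fun i => (c i).1 • a i + (c i).2 • b i) := fun c => rfl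
  have hg : ∀ i : Fin k, HasFDerivAt (fun t : ℝ => ((1 : ℝ), t))
      (ContinuousLinearMap.inr ℝ ℝ ℝ) 0 := fun i =>
    (hasFDerivAt_const (1 : ℝ) (0 : ℝ)).prodMk (hasFDerivAt_id (0 : ℝ))
  have hd := HasFDerivAt.multilinear_comp (f := toContinuousMultilinear ξ) hg
  have hfun : (fun t : ℝ => η (fun i => a i + t • b i))
      = fun t => toContinuousMultilinear ξ (fun _ => ((1 : ℝ), t)) := by
    funext t
    simp [hξ]
  have hval : ∑ i, η (Function.update a i (b i))
      = (∑ i, (toContinuousMultilinear ξ).toContinuousLinearMap (fun _ => ((1 : ℝ), (0 : ℝ))) i ∘L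
          ContinuousLinearMap.inr ℝ ℝ ℝ) 1 := by
    rw [sum_apply]
    refine Finset.sum_congr rfl fun i _ => ?_
    rw [ContinuousLinearMap.comp_apply, ContinuousMultilinearMap.toContinuousLinearMap_apply,
      toContinuousMultilinear_apply, hξ]
    congr 1
    funext j
    by_cases hj : j = i
    · subst hj; simp
    · simp [hj]
  rw [hfun, hval]
  exact hd.hasDerivAt

theorem map_update_const_of_symm {k : ℕ} {S : MultilinearMap ℝ (fun _ : Fin (k + 1) => V) ℝ}
    (hS : ∀ (s : Equiv.Perm (Fin (k + 1))) (w : Fin (k + 1) → V), S (fun i => w (s i)) = S w)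
    (u v : V) (i : Fin (k + 1)) :
    S (Function.update (fun _ => v) i u) = S (Matrix.vecCons u (fun _ => v)) := by
  rw [← hS (Equiv.swap 0 i)]
  congr 1
  funext j
  refine Fin.cases ?_ (fun j => ?_) j
  · simp
  · by_cases hj : j.succ = i
    · rw [hj, Equiv.swap_apply_right]
      subst hj
      simp [(Fin.succ_ne_zero j).symm]
    · rw [Equiv.swap_apply_of_ne_of_ne (Fin.succ_ne_zero j) hj]
      simp [hj]

theorem hasDerivAt_diag_of_symm {k : ℕ} {S : MultilinearMap ℝ (fun _ : Fin (k + 1) => V) ℝ}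
    (hS : ∀ (s : Equiv.Perm (Fin (k + 1))) (w : Fin (k + 1) → V), S (fun i => w (s i)) = S w)
    (u v : V) :
    HasDerivAt (fun t : ℝ => S (fun _ => v + t • u))
      (((k + 1 : ℕ) : ℝ) * S (Matrix.vecCons u (fun _ => v))) 0 := by
  convert hasDerivAt_multilinear S (fun _ => v) (fun _ => u) using 1
  simp [map_update_const_of_symm hS]

theorem ins_symm {V : Type*} {k : ℕ} {S : (Fin (k + 1) → V) → ℝ}
    (hS : ∀ (s : Equiv.Perm (Fin (k + 1))) (w : Fin (k + 1) → V), S (fun i => w (s i)) = S w)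
    (u : V) (s : Equiv.Perm (Fin k)) (w : Fin k → V) :
    ins u S (fun i => w (s i)) = ins u S w := by
  unfold ins
  rw [← hS (Equiv.Perm.decomposeFin.symm (0, s)) (Matrix.vecCons u w)]
  congr 1
  funext j
  refine Fin.cases ?_ (fun j => ?_) j <;> simp

/-- Induction on the degree: differentiating the diagonal at `v` in the direction `u` gives `(k + 1)
S(u, v, …, v)`, so freezing one slot of `S` leaves a symmetric map whose diagonal again vanishes. -/
theorem eq_zero_of_diag_eq_zero : ∀ {k : ℕ} {S : MultilinearMap ℝ (fun _ : Fin k => V) ℝ},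
    (∀ (s : Equiv.Perm (Fin k)) (w : Fin k → V), S (fun i => w (s i)) = S w) →
    (∀ v, S (fun _ => v) = 0) → S = 0
  | 0, S, _, hd => by
    ext w
    rw [Subsingleton.elim w (fun _ => 0), hd]
    rfl
  | k + 1, S, hS, hd => by
    have hcurry : ∀ u, S.curryLeft u = 0 := fun u => by
      refine eq_zero_of_diag_eq_zero (fun s w => ins_symm hS u s w) fun v => ?_
      have h1 := hasDerivAt_diag_of_symm hS u v
      simp only [hd] at h1
      have h2 := h1.unique (hasDerivAt_const 0 0)
      have h3 : ((k + 1 : ℕ) : ℝ) ≠ 0 := Nat.cast_ne_zero.mpr (Nat.succ_ne_zero k)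
      exact (mul_eq_zero.mp h2).resolve_left h3
    ext w
    have := congrArg (fun T => T (Fin.tail w)) (hcurry (w 0))
    simpa using this

/-- A symmetric multilinear map whose diagonal is harmonic is trace-free. -/
theorem trace_eq_zero_of_harmonic [Module.Finite ℝ V] {ι : Type*} [Fintype ι] [DecidableEq ι]
    {h : LinearMap.BilinForm ℝ V} {e : Module.Basis ι ℝ V} (he : IsOrthonormalBasis h e)
    {m : ℕ} {η : MultilinearMap ℝ (fun _ : Fin (m + 2) => V) ℝ} {P : V → ℝ}
    (hη : IsPolarization η P) (hP : ∀ v, laplacian h P v = 0) (w : Fin m → V) :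
    ∑ i, η (Matrix.vecCons (e i) (Matrix.vecCons (e i) w)) = 0 := by
  have hP' : P = fun x => η (fun _ => x) := funext hη.diag
  have h1 : ∀ y v, lineDeriv ℝ P y v = ((m + 2 : ℕ) : ℝ) * η (Matrix.vecCons v (fun _ => y)) := by
    intro y v
    rw [hP']
    exact (hasDerivAt_diag_of_symm hη.symm v y).deriv
  have h2 : ∀ x u v, lineDeriv ℝ (fun y => lineDeriv ℝ P y v) x u
      = ((m + 2 : ℕ) : ℝ) * (((m + 1 : ℕ) : ℝ) *
        η (Matrix.vecCons v (Matrix.vecCons u (fun _ => x)))) := by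
    intro x u v
    simp only [h1]
    have := (hasDerivAt_diag_of_symm (S := η.curryLeft v)
      (fun s w => ins_symm hη.symm v s w) u x).const_mul ((m + 2 : ℕ) : ℝ)
    exact this.deriv
  -- `T` is the trace of `η`. The Laplacian of `P` at `v` is `(m + 2)(m + 1) T(v, …, v)`, so
  -- harmonicity kills the diagonal of `T`, and `T` is symmetric.
  let T : MultilinearMap ℝ (fun _ : Fin m => V) ℝ :=
    ∑ i, (η.curryLeft (e i)).curryLeft (e i)
  have hT : ∀ w, T w = ∑ i, η (Matrix.vecCons (e i) (Matrix.vecCons (e i) w)) := fun w => by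
    simp only [T, sum_apply]
    rfl
  have hT0 : T = 0 := by
    refine eq_zero_of_diag_eq_zero (fun s w => ?_) fun v => ?_
    · simp only [hT]
      refine Finset.sum_congr rfl fun i _ => ?_
      exact ins_symm (S := η.curryLeft (e i)) (fun s w => ins_symm hη.symm (e i) s w) (e i) s w
    · have hv := hP v
      rw [laplacian] at hv
      simp only [h2] at hv
      let f : V →ₗ[ℝ] V →ₗ[ℝ] ℝ := LinearMap.mk₂ ℝ
        (fun u u' => ((m + 2 : ℕ) : ℝ) * (((m + 1 : ℕ) : ℝ) *
          (η.curryLeft u').curryLeft u (fun _ => v)))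
        (fun a b c => by simp [mul_add]) (fun a b c => by simp; ring)
        (fun a b c => by simp [mul_add]) (fun a b c => by simp; ring)
      have hf := he.contract_eq f
      have hf' : contract h (fun u u' => f u u') = 0 := hv
      rw [hf'] at hf
      have hc : ((m + 2 : ℕ) : ℝ) ≠ 0 := by positivity
      have hc' : ((m + 1 : ℕ) : ℝ) ≠ 0 := by positivity
      have : ((m + 2 : ℕ) : ℝ) * (((m + 1 : ℕ) : ℝ) * T (fun _ => v)) = 0 := by
        rw [hf, hT, Finset.mul_sum, Finset.mul_sum]
        rfl
      exact (mul_eq_zero.mp ((mul_eq_zero.mp this).resolve_left hc)).resolve_left hc'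
  rw [← hT, hT0]
  rfl

end Polarization

/-! ### The Ricci contraction of a symmetric trace-free tensor -/

section RicciContraction

variable {V : Type*} [AddCommGroup V] [Module ℝ V] [Module.Finite ℝ V]
  {ι : Type*} [Fintype ι] [DecidableEq ι] {h : LinearMap.BilinForm ℝ V}
  {e : Module.Basis ι ℝ V} {m : ℕ}

theorem IsOrthonormalBasis.ricciContraction_eq (he : IsOrthonormalBasis h e)
    (α β : MultilinearMap ℝ (fun _ : Fin (m + 1) => V) ℝ) (i j : V) :
    ricciContraction h α β i j = ∑ p : Fin m → ι,
      α (Matrix.vecCons i (fun s => e (p s))) * β (Matrix.vecCons j (fun s => e (p s))) :=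
  he.pairing_eq (α.curryLeft i) (β.curryLeft j)

theorem sum_fin_succ_pi {ι : Type*} [Fintype ι] {m : ℕ} {M : Type*} [AddCommMonoid M]
    (f : (Fin (m + 1) → ι) → M) :
    ∑ p, f p = ∑ a, ∑ p : Fin m → ι, f (Matrix.vecCons a p) := by
  rw [← Fintype.sum_prod_type' fun a p => f (Matrix.vecCons a p)]
  exact (Fintype.sum_equiv (Fin.consEquiv fun _ => ι) _ _ fun _ => rfl).symm

theorem basis_comp_vecCons {V : Type*} [AddCommGroup V] [Module ℝ V] {ι : Type*}
    {e : Module.Basis ι ℝ V} {m : ℕ} (a : ι) (p : Fin m → ι) :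
    (fun s => e ((Matrix.vecCons a p : Fin (m + 1) → ι) s))
      = Matrix.vecCons (e a) (fun s => e (p s)) := by
  funext s
  refine Fin.cases ?_ (fun s => ?_) s <;> simp

theorem IsOrthonormalBasis.normSq_eq (he : IsOrthonormalBasis h e)
    (η : MultilinearMap ℝ (fun _ : Fin (m + 1) => V) ℝ) :
    normSq h η = ∑ a, ricciContraction h η η (e a) (e a) := by
  rw [normSq, he.pairing_eq, sum_fin_succ_pi]
  simp only [he.ricciContraction_eq, basis_comp_vecCons]

/-- The contraction `η_i^{p₁ … pₘ} η_{j p₁ … pₘ}` as a bilinear form. -/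
def ricciForm (e : Module.Basis ι ℝ V) (η : MultilinearMap ℝ (fun _ : Fin (m + 1) => V) ℝ) :
    LinearMap.BilinForm ℝ V :=
  LinearMap.mk₂ ℝ (fun i j => ∑ p : Fin m → ι,
      η.curryLeft i (fun s => e (p s)) * η.curryLeft j (fun s => e (p s)))
    (fun a b c => by simp [add_mul, Finset.sum_add_distrib])
    (fun a b c => by simp [Finset.mul_sum, mul_assoc])
    (fun a b c => by simp [mul_add, Finset.sum_add_distrib])
    (fun a b c => by simp [Finset.mul_sum, mul_left_comm])

theorem map_vecCons_swap {V : Type*} [AddCommGroup V] [Module ℝ V] {m : ℕ}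
    {η : MultilinearMap ℝ (fun _ : Fin (m + 2) => V) ℝ}
    (hη : ∀ (s : Equiv.Perm (Fin (m + 2))) (w : Fin (m + 2) → V), η (fun i => w (s i)) = η w)
    (u v : V) (w : Fin m → V) :
    η (Matrix.vecCons u (Matrix.vecCons v w)) = η (Matrix.vecCons v (Matrix.vecCons u w)) := by
  rw [← hη (Equiv.swap 0 1)]
  congr 1
  funext s
  refine Fin.cases ?_ (fun s => Fin.cases ?_ (fun s => ?_) s) s
  · simp
  · simp
  · have h1 : s.succ.succ ≠ (1 : Fin (m + 2)) := fun hs =>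
      Fin.succ_ne_zero s (Fin.succ_injective _ hs)
    rw [Equiv.swap_apply_of_ne_of_ne (Fin.succ_ne_zero _) h1]
    simp

/-- On a diagonal pair `(e a, e a)` the four terms combine, by symmetry of `η`, into `⟨η_{ia},
η_{ja}⟩ - ⟨η_{ij}, η_{aa}⟩`. Summed over `a`, the second product contains the trace of `η` and
disappears. -/
theorem IsOrthonormalBasis.ricciTrace_kulkarniNomizu (he : IsOrthonormalBasis h e)
    {η : MultilinearMap ℝ (fun _ : Fin (m + 2) => V) ℝ}
    (hη : ∀ (s : Equiv.Perm (Fin (m + 2))) (w : Fin (m + 2) → V), η (fun i => w (s i)) = η w)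
    (htr : ∀ w, ∑ a, η (Matrix.vecCons (e a) (Matrix.vecCons (e a) w)) = 0) (i j : V) :
    ricciTrace h (kulkarniNomizu h η η) i j = ricciContraction h η η i j := by
  let N : V → V → (Fin m → ι) → ℝ := fun u v p => (η.curryLeft u).curryLeft v (fun s => e (p s))
  have hpair : ∀ a b c d, pairing h (ins b (ins a η)) (ins d (ins c η))
      = ∑ p, N a b p * N c d p := fun a b c d =>
    he.pairing_eq ((η.curryLeft a).curryLeft b) ((η.curryLeft c).curryLeft d)
  have hsw : ∀ u v p, N u v p = N v u p := fun u v p => map_vecCons_swap hη u v _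
  have hadd : ∀ u u' v p, N (u + u') v p = N u v p + N u' v p := fun u u' v p => by
    simp only [N, map_add]
    rfl
  have hadd' : ∀ u v v' p, N u (v + v') p = N u v p + N u v' p := fun u v v' p => by
    simp only [N, map_add, add_apply]
  have hsmul : ∀ (c : ℝ) u v p, N (c • u) v p = c * N u v p := fun c u v p => by
    simp only [N, map_smul]
    rfl
  have hsmul' : ∀ (c : ℝ) u v p, N u (c • v) p = c * N u v p := fun c u v p => by
    simp only [N, map_smul, smul_apply, smul_eq_mul]
  let f : V →ₗ[ℝ] V →ₗ[ℝ] ℝ := LinearMap.mk₂ ℝ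
    (fun p q => ∑ r, ((1 / 2) * (N j p r * N i q r - N j i r * N p q r)
      - (1 / 2) * (N q p r * N i j r - N q i r * N p j r)))
    (fun a b c => by
      rw [← Finset.sum_add_distrib]
      refine Finset.sum_congr rfl fun r _ => ?_
      simp only [hadd, hadd']; ring)
    (fun a b c => by
      rw [smul_eq_mul, Finset.mul_sum]
      refine Finset.sum_congr rfl fun r _ => ?_
      simp only [hsmul, hsmul']; ring)
    (fun a b c => by
      rw [← Finset.sum_add_distrib]
      refine Finset.sum_congr rfl fun r _ => ?_
      simp only [hadd, hadd']; ring)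
    (fun a b c => by
      rw [smul_eq_mul, Finset.mul_sum]
      refine Finset.sum_congr rfl fun r _ => ?_
      simp only [hsmul, hsmul']; ring)
  have hf : ricciTrace h (kulkarniNomizu h η η) i j = contract h (fun p q => f p q) := by
    unfold ricciTrace
    congr 1
    funext p q
    simp only [kulkarniNomizu, hpair, f, LinearMap.mk₂_apply, ← Finset.sum_sub_distrib,
      Finset.mul_sum]
  have hN : ∀ r, ∑ a, N (e a) (e a) r = 0 := fun r => htr _
  have hR : ricciContraction h η η i j = ∑ a, ∑ r, N i (e a) r * N j (e a) r := by
    rw [he.ricciContraction_eq, sum_fin_succ_pi]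
    simp only [basis_comp_vecCons]
    rfl
  rw [hf, he.contract_eq, hR]
  have hterm : ∀ a, f (e a) (e a) = ∑ r, N i (e a) r * N j (e a) r
      - ∑ r, N i j r * N (e a) (e a) r := by
    intro a
    rw [← Finset.sum_sub_distrib]
    refine Finset.sum_congr rfl fun r _ => ?_
    rw [hsw j i, hsw (e a) i, hsw (e a) j]
    ring
  simp only [hterm, Finset.sum_sub_distrib]
  rw [Finset.sum_comm (f := fun a r => N i j r * N (e a) (e a) r)]
  simp [← Finset.mul_sum, hN]

end RicciContraction

/-! ### Invariant forms on a simple Lie algebra -/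

section Invariant

variable {𝔤 : Type*} [LieRing 𝔤] [LieAlgebra ℝ 𝔤]
  {ι : Type*} [Fintype ι] [DecidableEq ι] {h : LinearMap.BilinForm ℝ 𝔤}
  {e : Module.Basis ι ℝ 𝔤} {m : ℕ}

/-- Infinitesimal invariance of a bilinear form under the adjoint representation. -/
def IsAdInvariant (q : LinearMap.BilinForm ℝ 𝔤) : Prop :=
  ∀ x u v : 𝔤, q ⁅x, u⁆ v + q u ⁅x, v⁆ = 0

/-- Invariance of `h` makes the matrix of `ad x` skew in an orthonormal basis, so moving `ad x` in
one contracted slot from `α` to `β` changes the sign. -/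
theorem IsOrthonormalBasis.sum_lie_pairing (he : IsOrthonormalBasis h e) (hh : IsAdInvariant h)
    (α β : MultilinearMap ℝ (fun _ : Fin m => 𝔤) ℝ) (x : 𝔤) (s : Fin m) :
    ∑ p : Fin m → ι,
      (α (Function.update (fun t => e (p t)) s ⁅x, e (p s)⁆) * β (fun t => e (p t))
        + α (fun t => e (p t)) * β (Function.update (fun t => e (p t)) s ⁅x, e (p s)⁆)) = 0 := by
  set C : ι → ι → ℝ := fun a b => e.repr ⁅x, e a⁆ b with hC
  have hskew : ∀ a b, C a b = - C b a := by
    intro a b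
    have h1 := hh x (e a) (e b)
    rw [he.apply_basis] at h1
    have h2 : h (e a) ⁅x, e b⁆ = C b a := by
      rw [he.apply_eq_sum]
      simp [hC, Finsupp.single_apply]
    rw [h2] at h1
    linarith
  have hexp : ∀ (γ : MultilinearMap ℝ (fun _ : Fin m => 𝔤) ℝ) (p : Fin m → ι),
      γ (Function.update (fun t => e (p t)) s ⁅x, e (p s)⁆)
        = ∑ b, C (p s) b * γ (fun t => e (Function.update p s b t)) := by
    intro γ p
    conv_lhs => rw [← e.sum_repr ⁅x, e (p s)⁆]
    rw [MultilinearMap.map_update_sum]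
    refine Finset.sum_congr rfl fun b _ => ?_
    rw [MultilinearMap.map_update_smul, smul_eq_mul]
    congr 2
    funext t
    by_cases ht : t = s
    · subst ht; simp
    · simp [ht]
  simp only [hexp, Finset.sum_add_distrib, Finset.sum_mul, Finset.mul_sum]
  rw [← Fintype.sum_prod_type', ← Fintype.sum_prod_type', add_eq_zero_iff_eq_neg,
    ← Finset.sum_neg_distrib]
  -- Exchanging the `s`-th entry of the multi-index with the expansion index of the bracket matches
  -- the two sums term by term, up to the sign of the skew matrix `C`.
  let σ : (Fin m → ι) × ι → (Fin m → ι) × ι := fun z => (Function.update z.1 s z.2, z.1 s)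
  have hσ : Function.Involutive σ := fun z => by simp [σ]
  refine Fintype.sum_equiv hσ.toPerm _ _ fun z => ?_
  simp only [Function.Involutive.coe_toPerm, σ, Function.update_self, Function.update_idem,
    Function.update_eq_self]
  rw [hskew (z.1 s) z.2]
  ring

/-- Invariance of `η` moves the bracket from the free slot onto the contracted ones, where the
contributions of the two factors cancel slot by slot by `IsOrthonormalBasis.sum_lie_pairing`. -/
theorem IsOrthonormalBasis.isAdInvariant_ricciForm (he : IsOrthonormalBasis h e)
    (hh : IsAdInvariant h) {η : MultilinearMap ℝ (fun _ : Fin (m + 1) => 𝔤) ℝ}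
    (hη : ∀ (x : 𝔤) (w : Fin (m + 1) → 𝔤), ∑ s, η (Function.update w s ⁅x, w s⁆) = 0) :
    IsAdInvariant (ricciForm e η) := by
  intro x i j
  have hη' : ∀ (i : 𝔤) (w : Fin m → 𝔤),
      η.curryLeft ⁅x, i⁆ w = - ∑ s, η.curryLeft i (Function.update w s ⁅x, w s⁆) := by
    intro i w
    have h1 := hη x (Matrix.vecCons i w)
    rw [Fin.sum_univ_succ] at h1
    have h2 : Function.update (Matrix.vecCons i w : Fin (m + 1) → 𝔤) 0 ⁅x, i⁆
        = Matrix.vecCons ⁅x, i⁆ w := Fin.update_cons_zero _ _ _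
    have h3 : ∀ s : Fin m, Function.update (Matrix.vecCons i w : Fin (m + 1) → 𝔤) s.succ ⁅x, w s⁆
        = Matrix.vecCons i (Function.update w s ⁅x, w s⁆) := fun s =>
      (Fin.cons_update (α := fun _ : Fin (m + 1) => 𝔤) i w s _).symm
    simp only [Matrix.cons_val_zero, Matrix.cons_val_succ, h2, h3] at h1
    exact eq_neg_of_add_eq_zero_left h1
  change ∑ p : Fin m → ι, η.curryLeft ⁅x, i⁆ (fun s => e (p s)) * η.curryLeft j (fun s => e (p s))
    + ∑ p : Fin m → ι, η.curryLeft i (fun s => e (p s)) * η.curryLeft ⁅x, j⁆ (fun s => e (p s)) = 0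
  simp only [hη', neg_mul, mul_neg, Finset.sum_neg_distrib, Finset.sum_mul, Finset.mul_sum]
  rw [← neg_add, neg_eq_zero, Finset.sum_comm,
    Finset.sum_comm (γ := Fin m → ι), ← Finset.sum_add_distrib]
  refine Finset.sum_eq_zero fun s _ => ?_
  rw [← Finset.sum_add_distrib]
  exact he.sum_lie_pairing hh (η.curryLeft i) (η.curryLeft j) x s

/-- On a simple Lie algebra, a symmetric invariant form is a multiple of a positive definite one. -/
theorem IsOrthonormalBasis.exists_eq_mul [LieAlgebra.IsSimple ℝ 𝔤] [Nonempty ι]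
    (he : IsOrthonormalBasis h e) (hh : IsAdInvariant h) {q : LinearMap.BilinForm ℝ 𝔤}
    (hsymm : ∀ u v, q u v = q v u) (hq : IsAdInvariant q) :
    ∃ c : ℝ, ∀ u v, q u v = c * h u v := by
  -- Symmetry of `q` makes `M` a real symmetric matrix, so it has a real eigenvalue `c`; over `ℝ`
  -- this is what replaces algebraic closedness in Schur's lemma.
  let M : Matrix ι ι ℝ := Matrix.of fun i j => q (e i) (e j)
  have hM : M.IsHermitian := by
    ext i j
    simp [M, hsymm]
  let i₀ : ι := Classical.arbitrary ι
  let x : ι → ℝ := hM.eigenvectorBasis i₀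
  let c : ℝ := hM.eigenvalues i₀
  have hx : M.mulVec x = c • x := hM.mulVec_eigenvectorBasis i₀
  let u : 𝔤 := ∑ j, x j • e j
  have hrepr : ∀ i, e.repr u i = x i := fun i => by
    simp [u, Finsupp.single_apply]
  have hu0 : u ≠ 0 := by
    intro h0
    refine hM.eigenvectorBasis.orthonormal.ne_zero i₀ ?_
    ext i
    have := hrepr i
    rw [h0] at this
    simpa using this.symm
  have hu : ∀ w, q w u = c * h w u := by
    intro w
    have hb : ∀ i, q (e i) u = c * h (e i) u := fun i => by
      have h1 := congrFun hx i
      rw [he.apply_eq_sum]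
      simp only [Matrix.mulVec, dotProduct, M, Matrix.of_apply, Pi.smul_apply, smul_eq_mul] at h1
      simp only [u, map_sum, map_smul, smul_eq_mul]
      rw [← hrepr] at h1
      simp only [u, map_sum, map_smul, Module.Basis.repr_self] at h1 ⊢
      simpa [Finsupp.single_apply, mul_comm] using h1
    rw [← e.sum_repr w]
    simp only [map_sum, map_smul, LinearMap.sum_apply, LinearMap.smul_apply, smul_eq_mul, hb,
      Finset.mul_sum]
    exact Finset.sum_congr rfl fun i _ => by ring
  -- The eigenspace of `q` relative to `h` for `c` is an ideal because both forms are invariant. It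
  -- contains `u ≠ 0`, so simplicity makes it everything.
  let J : LieIdeal ℝ 𝔤 :=
    { carrier := {v | ∀ w, q w v = c * h w v}
      add_mem' := fun {a b} ha hb w => by rw [map_add, map_add, ha w, hb w, mul_add]
      zero_mem' := fun w => by simp
      smul_mem' := fun r a ha w => by
        rw [map_smul, map_smul, ha w, smul_eq_mul, smul_eq_mul]; ring
      lie_mem := fun {y v} hv w => by
        have h1 := hq y w v
        have h2 := hh y w v
        have h3 : q ⁅y, w⁆ v = c * h ⁅y, w⁆ v := hv _
        linear_combination h1 - c * h2 - h3 }
  have hJ : J = ⊤ := (LieAlgebra.IsSimple.eq_bot_or_eq_top J).resolve_left fun hbot => hu0 <| by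
    have : u ∈ J := hu
    rwa [hbot, LieSubmodule.mem_bot] at this
  refine ⟨c, fun w v => ?_⟩
  have hv : v ∈ J := by rw [hJ]; exact LieSubmodule.mem_top v
  exact hv w

end Invariant

/-! ### The Killing form in the presence of an invariant inner product -/

theorem exists_isOrthonormalBasis {V : Type*} [AddCommGroup V] [Module ℝ V] [Module.Finite ℝ V]
    {h : LinearMap.BilinForm ℝ V} (hsymm : ∀ u v, h u v = h v u) (hpos : ∀ u ≠ 0, 0 < h u u) :
    ∃ e : Module.Basis (Fin (Module.finrank ℝ V)) ℝ V, IsOrthonormalBasis h e := by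
  obtain ⟨v, hv⟩ := LinearMap.BilinForm.exists_orthogonal_basis (B := h) ⟨fun x y => hsymm x y⟩
  have hvpos : ∀ i, 0 < h (v i) (v i) := fun i => hpos _ (v.ne_zero i)
  have hunit : ∀ i, IsUnit (Real.sqrt (h (v i) (v i)))⁻¹ := fun i =>
    (isUnit_iff_ne_zero.mpr (Real.sqrt_pos.mpr (hvpos i)).ne').inv
  refine ⟨v.isUnitSMul hunit, fun i j => ?_⟩
  simp only [Module.Basis.isUnitSMul_apply, map_smul, LinearMap.smul_apply, smul_eq_mul]
  split_ifs with hij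
  · subst hij
    have h1 := Real.mul_self_sqrt (hvpos i).le
    have h2 := (Real.sqrt_pos.mpr (hvpos i)).ne'
    field_simp
    linarith
  · have : h (v i) (v j) = 0 := hv hij
    rw [this]
    simp

section Killing

variable {𝔤 : Type*} [LieRing 𝔤] [LieAlgebra ℝ 𝔤]

theorem isAdInvariant_neg_killingForm : IsAdInvariant (-killingForm ℝ 𝔤) := fun x u v => by
  have := LieModule.traceForm_apply_lie_apply' ℝ 𝔤 𝔤 x u v
  simp only [LinearMap.neg_apply]
  rw [killingForm, this]
  ring

theorem neg_killingForm_comm (u v : 𝔤) :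
    (-killingForm ℝ 𝔤) u v = (-killingForm ℝ 𝔤) v u := by
  simp only [LinearMap.neg_apply]
  rw [killingForm, LieModule.traceForm_comm]

theorem IsOrthonormalBasis.neg_killingForm_apply {ι : Type*} [Fintype ι] [DecidableEq ι]
    {q : LinearMap.BilinForm ℝ 𝔤} {e : Module.Basis ι ℝ 𝔤} (he : IsOrthonormalBasis q e)
    (x y : 𝔤) : (-killingForm ℝ 𝔤) x y = - ∑ i, q ⁅x, ⁅y, e i⁆⁆ (e i) := by
  rw [LinearMap.neg_apply, LinearMap.neg_apply, killingForm_apply_apply,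
    LinearMap.trace_eq_matrix_trace ℝ e]
  simp [Matrix.trace, LinearMap.toMatrix_apply, he.apply_basis]

/-- If a Lie algebra with trivial centre carries an invariant inner product, then its Killing form
is negative definite. -/
theorem neg_killingForm_pos [Module.Finite ℝ 𝔤] (hcenter : LieAlgebra.center ℝ 𝔤 = ⊥)
    {q : LinearMap.BilinForm ℝ 𝔤} (hsymm : ∀ u v, q u v = q v u) (hpos : ∀ u ≠ 0, 0 < q u u)
    (hq : IsAdInvariant q) {x : 𝔤} (hx : x ≠ 0) : 0 < (-killingForm ℝ 𝔤) x x := by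
  obtain ⟨e, he⟩ := exists_isOrthonormalBasis hsymm hpos
  have hnonneg : ∀ u, 0 ≤ q u u := fun u => by
    by_cases hu : u = 0
    · simp [hu]
    · exact (hpos u hu).le
  -- Skewness of `ad x` for `q` turns the trace of `-(ad x)²` into a sum of squares.
  have hsum : (-killingForm ℝ 𝔤) x x = ∑ i, q ⁅x, e i⁆ ⁅x, e i⁆ := by
    rw [he.neg_killingForm_apply, ← Finset.sum_neg_distrib]
    refine Finset.sum_congr rfl fun i _ => ?_
    linarith [hq x ⁅x, e i⁆ (e i)]
  rw [hsum]
  refine (Finset.sum_nonneg fun i _ => hnonneg _).lt_of_ne fun h0 => hx ?_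
  have hz : ∀ i, ⁅x, e i⁆ = 0 := fun i => by
    have := (Finset.sum_eq_zero_iff_of_nonneg fun i _ => hnonneg _).mp h0.symm i (Finset.mem_univ i)
    by_contra hne
    exact (hpos _ hne).ne' this
  have had : LieAlgebra.ad ℝ 𝔤 x = 0 := e.ext fun i => by simpa using hz i
  have : x ∈ LieAlgebra.center ℝ 𝔤 := by
    rw [LieModule.mem_maxTrivSubmodule]
    intro y
    have hy : ⁅x, y⁆ = 0 := LinearMap.congr_fun had y
    rw [← lie_skew, hy, neg_zero]
  rwa [hcenter, LieSubmodule.mem_bot] at this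

end Killing

/-! ### Smoothness of the left trivialization and of the adjoint action -/

section Smoothness

variable {E : Type*} [NormedAddCommGroup E] [NormedSpace ℝ E]

/-- A smooth map to the tangent bundle over a constant base point is a smooth map to the fibre. -/
theorem contMDiff_of_totalSpace_mk {H : Type*} [TopologicalSpace H] {I : ModelWithCorners ℝ E H}
    {M : Type*} [TopologicalSpace M] [ChartedSpace H M] [IsManifold I 1 M]
    {E' : Type*} [NormedAddCommGroup E'] [NormedSpace ℝ E'] {H' : Type*} [TopologicalSpace H']
    {J : ModelWithCorners ℝ E' H'} {N : Type*} [TopologicalSpace N] [ChartedSpace H' N]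
    {n : ℕ∞ω} {x : M} {f : N → E}
    (hf : ContMDiff J I.tangent n
      (fun y => (Bundle.TotalSpace.mk' E x (f y) : TangentBundle I M))) :
    ContMDiff J 𝓘(ℝ, E) n f := by
  intro y
  have h1 := (Bundle.contMDiffAt_totalSpace.mp (hf y)).2
  refine h1.congr_of_eventuallyEq (Filter.Eventually.of_forall fun z => ?_)
  simp only [TangentBundle.trivializationAt_apply]
  exact (tangentCoordChange_self (I := I) (x := x) (z := x) (v := f z)
    (mem_extChartAt_source x)).symm

/-- Used when a tangent map of a two-variable product is evaluated on a zero vector in one factor: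
the term `A 0` drops out, and the base point agrees only up to a propositional equality. -/
theorem totalSpace_mk_add_congr {H : Type*} [TopologicalSpace H] {I : ModelWithCorners ℝ E H}
    {M : Type*} [TopologicalSpace M] [ChartedSpace H M] {x y : M} (hxy : x = y) (A B : E →L[ℝ] E)
    (v : E) : (Bundle.TotalSpace.mk' E x (B v) : TangentBundle I M)
      = Bundle.TotalSpace.mk' E y (A 0 + B v) := by
  subst hxy
  rw [map_zero, zero_add]

variable {G : Type*} [TopologicalSpace G] [ChartedSpace E G] [Group G] [LieGroup 𝓘(ℝ, E) ∞ G]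

theorem toLieAlgebra_mulInvariantVectorField (g : G) (v : GroupLieAlgebra 𝓘(ℝ, E) G) :
    toLieAlgebra g (mulInvariantVectorField v g) = v := by
  have A : mfderiv 𝓘(ℝ, E) 𝓘(ℝ, E) ((fun x : G => g⁻¹ * x) ∘ (fun x => g * x)) (1 : G) v = v := by
    have : ((fun x : G => g⁻¹ * x) ∘ (fun x => g * x)) = id := by ext x; simp
    rw [this, mfderiv_id]
    rfl
  rw [mfderiv_comp (I' := 𝓘(ℝ, E)) (1 : G)
    ((contMDiff_mul_left (n := ∞)).contMDiffAt.mdifferentiableAt (by simp))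
    ((contMDiff_mul_left (n := ∞)).contMDiffAt.mdifferentiableAt (by simp)), mul_one] at A
  exact A

theorem mulInvariantVectorField_toLieAlgebra (g : G) (v : TangentSpace 𝓘(ℝ, E) g) :
    mulInvariantVectorField (toLieAlgebra g v) g = v := by
  have A : mfderiv 𝓘(ℝ, E) 𝓘(ℝ, E) ((fun x : G => g * x) ∘ (fun x => g⁻¹ * x)) g v = v := by
    have : ((fun x : G => g * x) ∘ (fun x => g⁻¹ * x)) = id := by ext x; simp
    rw [this, mfderiv_id]
    rfl
  rw [mfderiv_comp (I' := 𝓘(ℝ, E)) g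
    ((contMDiff_mul_left (n := ∞)).contMDiffAt.mdifferentiableAt (by simp))
    ((contMDiff_mul_left (n := ∞)).contMDiffAt.mdifferentiableAt (by simp)), inv_mul_cancel] at A
  exact A

/-- The left trivialization of the tangent space at a point. -/
def leftTrivialization (g : G) : TangentSpace 𝓘(ℝ, E) g ≃ₗ[ℝ] GroupLieAlgebra 𝓘(ℝ, E) G where
  toLinearMap := toLieAlgebra g
  invFun v := mulInvariantVectorField v g
  left_inv v := mulInvariantVectorField_toLieAlgebra g v
  right_inv v := toLieAlgebra_mulInvariantVectorField g v

/-- The left trivialization of the tangent bundle, as a map to the model space. -/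
def leftCoordinates (z : TangentBundle 𝓘(ℝ, E) G) : E := toLieAlgebra z.proj z.snd

/-- The trivialization is the tangent map of `(a, b) ↦ a⁻¹ b` evaluated on the pair `(0_g, v)`.
Tangent maps of smooth maps are smooth, so joint smoothness in `g` and `v` comes for free. -/
theorem contMDiff_leftCoordinates :
    ContMDiff 𝓘(ℝ, E).tangent 𝓘(ℝ, E) ∞ (leftCoordinates (E := E) (G := G)) := by
  let F₁ : TangentBundle 𝓘(ℝ, E) G → TangentBundle 𝓘(ℝ, E) G × TangentBundle 𝓘(ℝ, E) G :=
    fun z => (Bundle.TotalSpace.mk' E z.proj 0, z)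
  have S₁ : ContMDiff 𝓘(ℝ, E).tangent (𝓘(ℝ, E).tangent.prod 𝓘(ℝ, E).tangent) ∞ F₁ :=
    ((Bundle.contMDiff_zeroSection ℝ (TangentSpace 𝓘(ℝ, E) : G → Type _)).comp
      (Bundle.contMDiff_proj _)).prodMk contMDiff_id
  let F₂ := (equivTangentBundleProd 𝓘(ℝ, E) G 𝓘(ℝ, E) G).symm
  have S₂ : ContMDiff _ _ ∞ F₂ := contMDiff_equivTangentBundleProd_symm
  let μ : G × G → G := fun p => p.1⁻¹ * p.2
  have hμ : ContMDiff (𝓘(ℝ, E).prod 𝓘(ℝ, E)) 𝓘(ℝ, E) ∞ μ :=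
    (contMDiff_fst.inv).mul contMDiff_snd
  let F₃ := tangentMap (𝓘(ℝ, E).prod 𝓘(ℝ, E)) 𝓘(ℝ, E) μ
  have S₃ : ContMDiff _ _ ∞ F₃ := hμ.contMDiff_tangentMap (m := ∞) (by simp)
  refine contMDiff_of_totalSpace_mk (I := 𝓘(ℝ, E)) (x := (1 : G)) ?_
  convert (S₃.comp S₂).comp S₁ using 1
  funext z
  obtain ⟨g, v⟩ := z
  simp only [Function.comp_apply, tangentMap, F₃, F₂, F₁]
  rw [mfderiv_prod_eq_add_apply (hμ.mdifferentiable (by simp)).mdifferentiableAt]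
  exact totalSpace_mk_add_congr (inv_mul_cancel g).symm _ _ _

/-- The orbit of a vector under the adjoint action, as a map to the model space. -/
def adjointOrbit (v : GroupLieAlgebra 𝓘(ℝ, E) G) (g : G) : E := adjointAction g v

/-- The same device with `(a, b) ↦ a b a⁻¹` evaluated on `(0_g, v)`, where `v` sits over the
identity. -/
theorem contMDiff_adjointOrbit (v : GroupLieAlgebra 𝓘(ℝ, E) G) :
    ContMDiff 𝓘(ℝ, E) 𝓘(ℝ, E) ∞ (adjointOrbit v) := by
  let F₁ : G → TangentBundle 𝓘(ℝ, E) G × TangentBundle 𝓘(ℝ, E) G :=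
    fun g => (Bundle.TotalSpace.mk' E g 0, Bundle.TotalSpace.mk' E 1 v)
  have S₁ : ContMDiff 𝓘(ℝ, E) (𝓘(ℝ, E).tangent.prod 𝓘(ℝ, E).tangent) ∞ F₁ :=
    (Bundle.contMDiff_zeroSection ℝ (TangentSpace 𝓘(ℝ, E) : G → Type _)).prodMk contMDiff_const
  let F₂ := (equivTangentBundleProd 𝓘(ℝ, E) G 𝓘(ℝ, E) G).symm
  have S₂ : ContMDiff _ _ ∞ F₂ := contMDiff_equivTangentBundleProd_symm
  let μ : G × G → G := fun p => p.1 * p.2 * p.1⁻¹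
  have hμ : ContMDiff (𝓘(ℝ, E).prod 𝓘(ℝ, E)) 𝓘(ℝ, E) ∞ μ :=
    (contMDiff_fst.mul contMDiff_snd).mul contMDiff_fst.inv
  let F₃ := tangentMap (𝓘(ℝ, E).prod 𝓘(ℝ, E)) 𝓘(ℝ, E) μ
  have S₃ : ContMDiff _ _ ∞ F₃ := hμ.contMDiff_tangentMap (m := ∞) (by simp)
  refine contMDiff_of_totalSpace_mk (I := 𝓘(ℝ, E)) (x := (1 : G)) ?_
  convert (S₃.comp S₂).comp S₁ using 1
  funext g
  simp only [Function.comp_apply, tangentMap, F₃, F₂, F₁]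
  rw [mfderiv_prod_eq_add_apply (hμ.mdifferentiable (by simp)).mdifferentiableAt]
  exact totalSpace_mk_add_congr (by simp [μ]) _ _ _

/-- The components of a vector field in the left trivialization. -/
def components (X : ∀ g : G, TangentSpace 𝓘(ℝ, E) g) (g : G) : E := toLieAlgebra g (X g)

theorem contMDiffAt_components {n : ℕ∞ω} (hn : n ≤ ∞) {X : ∀ g : G, TangentSpace 𝓘(ℝ, E) g} {x : G}
    (hX : ContMDiffAt 𝓘(ℝ, E) 𝓘(ℝ, E).tangent n
      (fun g => (X g : TangentBundle 𝓘(ℝ, E) G)) x) :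
    ContMDiffAt 𝓘(ℝ, E) 𝓘(ℝ, E) n (components X) x :=
  ((contMDiff_leftCoordinates.of_le hn).contMDiffAt).comp x hX

theorem mdifferentiableAt_components {X : ∀ g : G, TangentSpace 𝓘(ℝ, E) g} {x : G}
    (hX : MDifferentiableAt 𝓘(ℝ, E) 𝓘(ℝ, E).tangent
      (fun g => (X g : TangentBundle 𝓘(ℝ, E) G)) x) :
    MDifferentiableAt 𝓘(ℝ, E) 𝓘(ℝ, E) (components X) x :=
  ((contMDiff_leftCoordinates.mdifferentiable (by simp)).mdifferentiableAt).comp x hX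

end Smoothness

/-! ### The differential of the adjoint action -/

section AdjointDifferential

open Filter Topology VectorField

variable {E : Type*} [NormedAddCommGroup E] [NormedSpace ℝ E]

theorem hasFDerivAt_fderiv_apply {E' F : Type*} [NormedAddCommGroup E'] [NormedSpace ℝ E']
    [NormedAddCommGroup F] [NormedSpace ℝ F] {μ : E' → F} {ι : E → E'} {ι' : E →L[ℝ] E'}
    {w : E → E'}
    {w' : E →L[ℝ] E'} {e : E} (hμ : ContDiffAt ℝ 2 μ (ι e)) (hι : HasFDerivAt ι ι' e)
    (hw : HasFDerivAt w w' e) :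
    HasFDerivAt (fun a => fderiv ℝ μ (ι a) (w a))
      ((fderiv ℝ μ (ι e)).comp w' + ((fderiv ℝ (fderiv ℝ μ) (ι e)).comp ι').flip (w e)) e := by
  have h1 : DifferentiableAt ℝ (fderiv ℝ μ) (ι e) :=
    (hμ.fderiv_right (m := 1) (by norm_num)).differentiableAt (by norm_num)
  exact (h1.hasFDerivAt.comp e hι).clm_apply hw

/-- The differential of `a ↦ Ad_a v` from a local group law `μ` and the identity
`∂₁μ(e, a) (Ad_a v) = ∂₂μ(a, e) v`. -/
theorem fderiv_adjoint_of_local {μ : E × E → E} {e : E} (hμ : ContDiffAt ℝ 2 μ (e, e))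
    {f : E → E} {v : E} (hf : DifferentiableAt ℝ f e) (hfe : f e = v)
    (hid : ∀ u, fderiv ℝ μ (e, e) (u, 0) = u)
    (heq : ∀ᶠ a in 𝓝 e, fderiv ℝ μ (e, a) (f a, 0) = fderiv ℝ μ (a, e) (0, v)) (x : E) :
    fderiv ℝ f e x = fderiv ℝ (fun a => fderiv ℝ μ (a, e) (0, v)) e x
      - fderiv ℝ (fun a => fderiv ℝ μ (a, e) (0, x)) e v := by
  have hsymm : IsSymmSndFDerivAt ℝ μ (e, e) := hμ.isSymmSndFDerivAt (by simp)
  have hl : HasFDerivAt (fun a : E => (a, e)) (ContinuousLinearMap.inl ℝ E E) e :=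
    (hasFDerivAt_id e).prodMk (hasFDerivAt_const e e)
  have hr : HasFDerivAt (fun a : E => (e, a)) (ContinuousLinearMap.inr ℝ E E) e :=
    (hasFDerivAt_const e e).prodMk (hasFDerivAt_id e)
  have hR : ∀ w : E, HasFDerivAt (fun a => fderiv ℝ μ (a, e) (0, w)) _ e := fun w =>
    hasFDerivAt_fderiv_apply (ι := fun a => (a, e)) hμ hl (hasFDerivAt_const ((0 : E), w) e)
  have hL : HasFDerivAt (fun a => fderiv ℝ μ (e, a) (f a, 0)) _ e :=
    hasFDerivAt_fderiv_apply (ι := fun a => (e, a)) hμ hr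
      (hf.hasFDerivAt.prodMk (hasFDerivAt_const (0 : E) e))
  -- Differentiating the identity at `e` along `x` gives `f' x + D²μ(0, x)(v, 0) = D²μ(x, 0)(0, v)`.
  -- Symmetry of `D²μ` rewrites the middle term as the derivative along `v` of `a ↦ ∂₂μ(a, e) x`.
  have h1 := (hL.congr_of_eventuallyEq (EventuallyEq.symm heq)).unique (hR v)
  have h2 := DFunLike.congr_fun h1 x
  rw [(hR v).fderiv, (hR x).fderiv]
  simp only [add_apply, ContinuousLinearMap.comp_apply,
    ContinuousLinearMap.flip_apply, ContinuousLinearMap.prod_apply, hid, hfe,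
    zero_apply, map_zero, zero_add, ContinuousLinearMap.inl_apply,
    ContinuousLinearMap.inr_apply] at h2 ⊢
  rw [← h2, hsymm (v, 0) (0, x)]
  abel

variable {G : Type*} [TopologicalSpace G] [ChartedSpace E G] [Group G]

variable (E G) in
/-- The group law in the preferred chart at the identity. -/
def chartMul (p : E × E) : E :=
  extChartAt 𝓘(ℝ, E) (1 : G)
    ((extChartAt 𝓘(ℝ, E) (1 : G)).symm p.1 * (extChartAt 𝓘(ℝ, E) (1 : G)).symm p.2)

variable (E G) in
/-- The image of the identity in the preferred chart. -/
def chartOne : E := extChartAt 𝓘(ℝ, E) (1 : G) 1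

theorem chart_symm_chartOne : (extChartAt 𝓘(ℝ, E) (1 : G)).symm (chartOne E G) = 1 :=
  extChartAt_to_inv (1 : G)

theorem adjointOrbit_one (v : GroupLieAlgebra 𝓘(ℝ, E) G) : adjointOrbit v (1 : G) = v := by
  have : (fun y : G => 1 * y * (1 : G)⁻¹) = id := by funext y; simp
  unfold adjointOrbit adjointAction
  rw [this, mfderiv_id]
  rfl

variable [LieGroup 𝓘(ℝ, E) ∞ G]

theorem contMDiffAt_chart_symm :
    ContMDiffAt 𝓘(ℝ, E) 𝓘(ℝ, E) ∞ (extChartAt 𝓘(ℝ, E) (1 : G)).symm (chartOne E G) :=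
  (contMDiffOn_extChartAt_symm (1 : G)).contMDiffAt (extChartAt_target_mem_nhds (1 : G))

/-- The differential of the chart applied to a tangent vector carried by a map fixing the source. -/
theorem mfderiv_chart_mfderiv {k : G → G} (hk : ContMDiff 𝓘(ℝ, E) 𝓘(ℝ, E) ∞ k) {y : G}
    (hy : k 1 = y) (hys : y ∈ (extChartAt 𝓘(ℝ, E) (1 : G)).source) (w : E) :
    mfderiv 𝓘(ℝ, E) 𝓘(ℝ, E) (extChartAt 𝓘(ℝ, E) (1 : G)) y
        (mfderiv 𝓘(ℝ, E) 𝓘(ℝ, E) k 1 w)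
      = fderiv ℝ (fun b => extChartAt 𝓘(ℝ, E) (1 : G)
          (k ((extChartAt 𝓘(ℝ, E) (1 : G)).symm b))) (chartOne E G) w := by
  subst hy
  set φ := extChartAt 𝓘(ℝ, E) (1 : G) with hφ
  have hψ : MDifferentiableAt 𝓘(ℝ, E) 𝓘(ℝ, E) φ.symm (chartOne E G) :=
    contMDiffAt_chart_symm.mdifferentiableAt (by simp)
  have h1 : φ.symm (chartOne E G) = 1 := chart_symm_chartOne
  have hkd : MDifferentiableAt 𝓘(ℝ, E) 𝓘(ℝ, E) k (φ.symm (chartOne E G)) :=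
    (hk.mdifferentiable (by simp)).mdifferentiableAt
  have hφd : MDifferentiableAt 𝓘(ℝ, E) 𝓘(ℝ, E) φ (k (φ.symm (chartOne E G))) := by
    refine mdifferentiableAt_extChartAt ?_
    rw [h1, ← extChartAt_source 𝓘(ℝ, E)]
    exact hys
  have hψ' : mfderiv 𝓘(ℝ, E) 𝓘(ℝ, E) φ.symm (chartOne E G) w = w := by
    have := mfderivWithin_range_extChartAt_symm (I := 𝓘(ℝ, E)) (x := (1 : G))
    rw [ModelWithCorners.range_eq_univ, mfderivWithin_univ] at this
    exact DFunLike.congr_fun this w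
  rw [← mfderiv_eq_fderiv]
  have hcomp : mfderiv 𝓘(ℝ, E) 𝓘(ℝ, E) (fun b => φ (k (φ.symm b))) (chartOne E G) w
      = mfderiv 𝓘(ℝ, E) 𝓘(ℝ, E) φ (k (φ.symm (chartOne E G)))
        (mfderiv 𝓘(ℝ, E) 𝓘(ℝ, E) k (φ.symm (chartOne E G))
          (mfderiv 𝓘(ℝ, E) 𝓘(ℝ, E) φ.symm (chartOne E G) w)) := by
    have e1 : (fun b => φ (k (φ.symm b))) = φ ∘ (k ∘ φ.symm) := rfl
    rw [e1, mfderiv_comp (chartOne E G) hφd (hkd.comp _ hψ), mfderiv_comp (chartOne E G) hkd hψ]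
    rfl
  -- The chart inverse returns to `1` only propositionally, so the derivatives live in different
  -- tangent spaces; reading the values in `E` lets the base point be substituted.
  have hpoint : ∀ p : G, p = 1 → (mfderiv 𝓘(ℝ, E) 𝓘(ℝ, E) φ (k p)
      (mfderiv 𝓘(ℝ, E) 𝓘(ℝ, E) k p w) : E)
      = mfderiv 𝓘(ℝ, E) 𝓘(ℝ, E) φ (k 1) (mfderiv 𝓘(ℝ, E) 𝓘(ℝ, E) k 1 w) := by
    rintro _ rfl
    rfl
  refine (hpoint _ h1).symm.trans (Eq.trans ?_ hcomp.symm)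
  exact congrArg (fun u : E => (mfderiv 𝓘(ℝ, E) 𝓘(ℝ, E) φ (k (φ.symm (chartOne E G)))
      (mfderiv 𝓘(ℝ, E) 𝓘(ℝ, E) k (φ.symm (chartOne E G)) u) : E)) hψ'.symm

theorem contDiffAt_chartMul : ContDiffAt ℝ ∞ (chartMul E G) (chartOne E G, chartOne E G) := by
  rw [← contMDiffAt_iff_contDiffAt]
  have h1 : ContMDiffAt 𝓘(ℝ, E × E) 𝓘(ℝ, E) ∞
      (fun p : E × E => (extChartAt 𝓘(ℝ, E) (1 : G)).symm p.1) (chartOne E G, chartOne E G) :=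
    ContMDiffAt.comp (chartOne E G, chartOne E G) (g := (extChartAt 𝓘(ℝ, E) (1 : G)).symm)
      (f := Prod.fst) contMDiffAt_chart_symm contDiff_fst.contMDiff.contMDiffAt
  have h2 : ContMDiffAt 𝓘(ℝ, E × E) 𝓘(ℝ, E) ∞
      (fun p : E × E => (extChartAt 𝓘(ℝ, E) (1 : G)).symm p.2) (chartOne E G, chartOne E G) :=
    ContMDiffAt.comp (chartOne E G, chartOne E G) (g := (extChartAt 𝓘(ℝ, E) (1 : G)).symm)
      (f := Prod.snd) contMDiffAt_chart_symm contDiff_snd.contMDiff.contMDiffAt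
  refine ContMDiffAt.comp (chartOne E G, chartOne E G) (g := extChartAt 𝓘(ℝ, E) (1 : G))
    ?_ (h1.mul h2)
  simp only [chart_symm_chartOne, mul_one]
  exact contMDiffAt_extChartAt

theorem tendsto_chart_symm :
    Tendsto (extChartAt 𝓘(ℝ, E) (1 : G)).symm (𝓝 (chartOne E G)) (𝓝 1) := by
  have := (contMDiffAt_chart_symm (E := E) (G := G)).continuousAt
  rwa [ContinuousAt, chart_symm_chartOne] at this

theorem eventually_mem_source :
    ∀ᶠ a in 𝓝 (chartOne E G), (extChartAt 𝓘(ℝ, E) (1 : G)).symm a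
      ∈ (extChartAt 𝓘(ℝ, E) (1 : G)).source :=
  tendsto_chart_symm (extChartAt_source_mem_nhds (1 : G))

theorem eventually_differentiableAt_chartMul :
    ∀ᶠ p in 𝓝 (chartOne E G, chartOne E G), DifferentiableAt ℝ (chartMul E G) p := by
  have h := ((contDiffAt_chartMul (E := E) (G := G)).of_le
    (show (1 : ℕ∞ω) ≤ ∞ by exact_mod_cast le_top)).eventually (by simp)
  exact h.mono fun p hp => hp.differentiableAt (by simp)

/-- In the chart, the left-invariant field with value `w` is `a ↦ ∂₂μ(a, e) w`, where `μ` is the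
local group law and `e` the image of the identity. -/
theorem eventually_fderiv_right :
    ∀ᶠ a in 𝓝 (chartOne E G), ∀ w : E,
      mfderiv 𝓘(ℝ, E) 𝓘(ℝ, E) (extChartAt 𝓘(ℝ, E) (1 : G))
          ((extChartAt 𝓘(ℝ, E) (1 : G)).symm a)
          (mulInvariantVectorField (I := 𝓘(ℝ, E)) w ((extChartAt 𝓘(ℝ, E) (1 : G)).symm a))
        = fderiv ℝ (chartMul E G) (a, chartOne E G) (0, w) := by
  have ht : Tendsto (fun a : E => (a, chartOne E G)) (𝓝 (chartOne E G))
      (𝓝 (chartOne E G, chartOne E G)) := by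
    exact (continuous_id.prodMk continuous_const).continuousAt
  filter_upwards [eventually_mem_source (E := E) (G := G),
    ht.eventually eventually_differentiableAt_chartMul] with a ha hd w
  set g := (extChartAt 𝓘(ℝ, E) (1 : G)).symm a
  have h1 := mfderiv_chart_mfderiv (k := fun y : G => g * y) contMDiff_mul_left
    (mul_one g) ha w
  have hc : HasFDerivAt (fun b : E => (a, b)) (ContinuousLinearMap.inr ℝ E E) (chartOne E G) :=
    (hasFDerivAt_const a _).prodMk (hasFDerivAt_id _)
  have h2 := (hd.hasFDerivAt.comp (chartOne E G) hc).fderiv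
  refine h1.trans ?_
  exact DFunLike.congr_fun h2 w

theorem eventually_fderiv_left :
    ∀ᶠ a in 𝓝 (chartOne E G), ∀ w : E,
      mfderiv 𝓘(ℝ, E) 𝓘(ℝ, E) (extChartAt 𝓘(ℝ, E) (1 : G))
          ((extChartAt 𝓘(ℝ, E) (1 : G)).symm a)
          (mfderiv 𝓘(ℝ, E) 𝓘(ℝ, E)
            (fun y : G => y * (extChartAt 𝓘(ℝ, E) (1 : G)).symm a) 1 w)
        = fderiv ℝ (chartMul E G) (chartOne E G, a) (w, 0) := by
  have ht : Tendsto (fun a : E => (chartOne E G, a)) (𝓝 (chartOne E G))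
      (𝓝 (chartOne E G, chartOne E G)) := by
    exact (continuous_const.prodMk continuous_id).continuousAt
  filter_upwards [eventually_mem_source (E := E) (G := G),
    ht.eventually eventually_differentiableAt_chartMul] with a ha hd w
  set g := (extChartAt 𝓘(ℝ, E) (1 : G)).symm a
  have h1 := mfderiv_chart_mfderiv (k := fun y : G => y * g) contMDiff_mul_right
    (one_mul g) ha w
  have hc : HasFDerivAt (fun b : E => (b, a)) (ContinuousLinearMap.inl ℝ E E) (chartOne E G) :=
    (hasFDerivAt_id _).prodMk (hasFDerivAt_const a _)
  have h2 := (hd.hasFDerivAt.comp (chartOne E G) hc).fderiv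
  refine h1.trans ?_
  exact DFunLike.congr_fun h2 w

/-- Differentiate `g y = (g y g⁻¹) g` at the identity. In the chart this is the hypothesis `∂₁μ(e,
a)(Ad_a v) = ∂₂μ(a, e) v` of `fderiv_adjoint_of_local`. -/
theorem mfderiv_mul_right_adjointAction (g : G) (v : GroupLieAlgebra 𝓘(ℝ, E) G) :
    mfderiv 𝓘(ℝ, E) 𝓘(ℝ, E) (fun y : G => y * g) 1 (adjointAction g v)
      = mfderiv 𝓘(ℝ, E) 𝓘(ℝ, E) (fun y : G => g * y) 1 v := by
  have hc : ContMDiff 𝓘(ℝ, E) 𝓘(ℝ, E) ∞ (fun y : G => g * y * g⁻¹) :=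
    (contMDiff_const.mul contMDiff_id).mul contMDiff_const
  have hg1 : g * 1 * g⁻¹ = 1 := by simp
  have he : (fun y : G => g * y) = (fun y => y * g) ∘ (fun y => g * y * g⁻¹) := by
    funext y
    simp
  have hr : MDifferentiableAt 𝓘(ℝ, E) 𝓘(ℝ, E) (fun y : G => y * g) (g * 1 * g⁻¹) :=
    ((contMDiff_mul_right (n := ∞)).mdifferentiable (by simp)).mdifferentiableAt
  rw [he, mfderiv_comp (1 : G) hr ((hc.mdifferentiable (by simp)).mdifferentiableAt), hg1]
  rfl

/-- The difference of derivatives produced by `fderiv_adjoint_of_local` is exactly the coordinate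
formula at `e` for the bracket of the two left-invariant fields, which also settles the sign. -/
theorem mfderiv_adjointOrbit [CompleteSpace E] (x v : GroupLieAlgebra 𝓘(ℝ, E) G) :
    mvfderiv 𝓘(ℝ, E) (adjointOrbit v) (1 : G) x = ⁅x, v⁆ := by
  set φ := extChartAt 𝓘(ℝ, E) (1 : G) with hφ
  have hF : MDifferentiableAt 𝓘(ℝ, E) 𝓘(ℝ, E) (adjointOrbit v) (1 : G) :=
    ((contMDiff_adjointOrbit v).mdifferentiable (by simp)).mdifferentiableAt
  have hlhs : mvfderiv 𝓘(ℝ, E) (adjointOrbit v) (1 : G) x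
      = fderiv ℝ (fun a => adjointOrbit v (φ.symm a)) (chartOne E G) x := by
    rw [hF.mvfderiv, ModelWithCorners.range_eq_univ, fderivWithin_univ]
    rfl
  have hpull : ∀ w : E, mpullbackWithin 𝓘(ℝ, E) 𝓘(ℝ, E) φ.symm
      (mulInvariantVectorField (I := 𝓘(ℝ, E)) (G := G) w) Set.univ
      =ᶠ[𝓝 (chartOne E G)] fun a => fderiv ℝ (chartMul E G) (a, chartOne E G) (0, w) := by
    intro w
    filter_upwards [eventually_fderiv_right (E := E) (G := G),
      extChartAt_target_mem_nhds (I := 𝓘(ℝ, E)) (1 : G)] with a ha hat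
    rw [mpullbackWithin_apply, ← ha w]
    have i1 := mfderiv_extChartAt_comp_mfderivWithin_extChartAt_symm (I := 𝓘(ℝ, E)) hat
    have i2 := mfderivWithin_extChartAt_symm_comp_mfderiv_extChartAt (I := 𝓘(ℝ, E)) hat
    rw [ModelWithCorners.range_eq_univ] at i1 i2
    rw [ContinuousLinearMap.inverse_eq i2 i1]
    rfl
  have hbr : ⁅x, v⁆ = lieBracket ℝ
      (fun a => fderiv ℝ (chartMul E G) (a, chartOne E G) (0, x))
      (fun a => fderiv ℝ (chartMul E G) (a, chartOne E G) (0, v)) (chartOne E G) := by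
    rw [GroupLieAlgebra.bracket_def, ← mlieBracketWithin_univ, mlieBracketWithin_apply,
      mfderiv_extChartAt_self]
    refine (DFunLike.congr_fun (ContinuousLinearMap.inverse_id (R := ℝ) (M := E)) _).trans ?_
    rw [ContinuousLinearMap.id_apply, ModelWithCorners.range_eq_univ, Set.preimage_univ,
      Set.inter_univ]
    refine (congrFun (lieBracketWithin_univ (𝕜 := ℝ) (E := E)) _).trans ?_
    exact (hpull x).lieBracket_vectorField_eq (hpull v)
  have hone : ∀ w : E, fderiv ℝ (chartMul E G) (chartOne E G, chartOne E G) (0, w) = w := by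
    intro w
    rw [← (eventually_fderiv_right (E := E) (G := G)).self_of_nhds w, chart_symm_chartOne,
      mfderiv_extChartAt_self]
    have : (fun y : G => 1 * y) = id := by funext y; simp
    unfold mulInvariantVectorField
    rw [this, mfderiv_id]
    rfl
  have hone' : ∀ w : E, fderiv ℝ (chartMul E G) (chartOne E G, chartOne E G) (w, 0) = w := by
    intro w
    rw [← (eventually_fderiv_left (E := E) (G := G)).self_of_nhds w, chart_symm_chartOne,
      mfderiv_extChartAt_self]
    have : (fun y : G => y * 1) = id := by funext y; simp
    rw [this, mfderiv_id]
    rfl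
  refine hlhs.trans (Eq.trans ?_ hbr.symm)
  refine Eq.trans ?_ (congrArg₂ (fun p q : E =>
    fderiv ℝ (fun a => fderiv ℝ (chartMul E G) (a, chartOne E G) (0, v)) (chartOne E G) p
      - fderiv ℝ (fun a => fderiv ℝ (chartMul E G) (a, chartOne E G) (0, x)) (chartOne E G) q)
    (hone x) (hone v)).symm
  refine fderiv_adjoint_of_local (contDiffAt_chartMul.of_le ENat.LEInfty.out) ?_ ?_
    hone' ?_ x
  · have : MDifferentiableAt 𝓘(ℝ, E) 𝓘(ℝ, E) (adjointOrbit v ∘ φ.symm) (chartOne E G) := by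
      refine MDifferentiableAt.comp (chartOne E G) (g := adjointOrbit v) ?_
        (contMDiffAt_chart_symm.mdifferentiableAt (by simp))
      exact ((contMDiff_adjointOrbit v).mdifferentiable (by simp)).mdifferentiableAt
    exact this.differentiableAt
  · rw [chart_symm_chartOne, adjointOrbit_one]
  · filter_upwards [eventually_fderiv_right (E := E) (G := G),
      eventually_fderiv_left (E := E) (G := G)] with a hr hl
    rw [← hr v, ← hl (adjointOrbit v (φ.symm a))]
    congr 1
    exact mfderiv_mul_right_adjointAction (φ.symm a) v

end AdjointDifferential

/-! ### Infinitesimal invariance -/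

section MultilinearOnManifold

variable {E : Type*} [NormedAddCommGroup E] [NormedSpace ℝ E] {H : Type*} [TopologicalSpace H]
  {I : ModelWithCorners ℝ E H} {M : Type*} [TopologicalSpace M] [ChartedSpace H M]
  {F : Type*} [NormedAddCommGroup F] [NormedSpace ℝ F]

theorem hasFDerivWithinAt_of_mdifferentiableAt {g : M → F} {x : M}
    (hg : MDifferentiableAt I 𝓘(ℝ, F) g x) :
    HasFDerivWithinAt (fun a => g ((extChartAt I x).symm a)) (mvfderiv I g x : E →L[ℝ] F)
      (Set.range I) (extChartAt I x x) :=
  hg.hasMFDerivAt.2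

theorem hasMFDerivAt_multilinear [FiniteDimensional ℝ F] {k : ℕ}
    (η : MultilinearMap ℝ (fun _ : Fin k => F) ℝ) {g : Fin k → M → F} {x : M}
    (hg : ∀ i, MDifferentiableAt I 𝓘(ℝ, F) (g i) x) :
    HasMFDerivAt I 𝓘(ℝ, ℝ) (fun y => η (fun i => g i y)) x
      (∑ i, (toContinuousMultilinear η).toContinuousLinearMap (fun j => g j x) i ∘L
        (mvfderiv I (g i) x : E →L[ℝ] F)) := by
  refine ⟨?_, ?_⟩
  · exact (toContinuousMultilinear η).cont.continuousAt.comp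
      (f := fun y i => g i y) (continuousAt_pi.mpr fun i => (hg i).continuousAt)
  · have := HasFDerivWithinAt.multilinear_comp (f := toContinuousMultilinear η)
      fun i => hasFDerivWithinAt_of_mdifferentiableAt (hg i)
    simp only [extChartAt_to_inv] at this
    exact this

theorem mvfderiv_multilinear [FiniteDimensional ℝ F] {k : ℕ}
    (η : MultilinearMap ℝ (fun _ : Fin k => F) ℝ) {g : Fin k → M → F} {x : M}
    (hg : ∀ i, MDifferentiableAt I 𝓘(ℝ, F) (g i) x) (v : TangentSpace I x) :
    mvfderiv I (fun y => η (fun i => g i y)) x v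
      = ∑ i, η (Function.update (fun j => g j x) i (mvfderiv I (g i) x v)) := by
  have h := DFunLike.congr_fun (hasMFDerivAt_multilinear η hg).mfderiv v
  refine h.trans ((sum_apply Finset.univ _ (v : E)).trans ?_)
  rfl

end MultilinearOnManifold

section Adjoint

variable {E : Type*} [NormedAddCommGroup E] [NormedSpace ℝ E]
  {G : Type*} [TopologicalSpace G] [ChartedSpace E G] [Group G] [LieGroup 𝓘(ℝ, E) ∞ G]

theorem adjointAction_mul (a b : G) (v : GroupLieAlgebra 𝓘(ℝ, E) G) :
    adjointAction (a * b) v = adjointAction a (adjointAction b v) := by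
  have hc : ∀ g : G, ContMDiff 𝓘(ℝ, E) 𝓘(ℝ, E) ∞ (fun y : G => g * y * g⁻¹) := fun g =>
    (contMDiff_const.mul contMDiff_id).mul contMDiff_const
  have he : (fun y : G => a * b * y * (a * b)⁻¹)
      = (fun y => a * y * a⁻¹) ∘ (fun y => b * y * b⁻¹) := by
    funext y
    simp [mul_assoc]
  have hb : b * 1 * b⁻¹ = 1 := by simp
  unfold adjointAction
  rw [he, mfderiv_comp (1 : G) ((hc a).mdifferentiable (by simp)).mdifferentiableAt
    ((hc b).mdifferentiable (by simp)).mdifferentiableAt, hb]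
  rfl

/-- The sum is a symmetric multilinear map in `w`, and its diagonal at `v` is the derivative at the
identity of the constant function `g ↦ P(Ad_g v)`. Polarization then gives the vanishing for all
`w`. -/
theorem sum_map_update_lie [FiniteDimensional ℝ E] [CompleteSpace E] {k : ℕ}
    {η : MultilinearMap ℝ (fun _ : Fin k => GroupLieAlgebra 𝓘(ℝ, E) G) ℝ}
    {P : GroupLieAlgebra 𝓘(ℝ, E) G → ℝ} (hη : IsPolarization η P)
    (hinv : ∀ (g : G) (v : GroupLieAlgebra 𝓘(ℝ, E) G), P (adjointAction g v) = P v)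
    (x : GroupLieAlgebra 𝓘(ℝ, E) G) (w : Fin k → GroupLieAlgebra 𝓘(ℝ, E) G) :
    ∑ s, η (Function.update w s ⁅x, w s⁆) = 0 := by
  let S : MultilinearMap ℝ (fun _ : Fin k => GroupLieAlgebra 𝓘(ℝ, E) G) ℝ :=
    ∑ s, η.compLinearMap (Function.update (fun _ => LinearMap.id) s
      (LieAlgebra.ad ℝ (GroupLieAlgebra 𝓘(ℝ, E) G) x))
  have hS : ∀ w, S w = ∑ s, η (Function.update w s ⁅x, w s⁆) := by
    intro w
    simp only [S, sum_apply, MultilinearMap.compLinearMap_apply]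
    refine Finset.sum_congr rfl fun s _ => congrArg η (funext fun i => ?_)
    by_cases h : i = s
    · subst h
      simp
    · simp [h]
  rw [← hS]
  have : S = 0 := by
    refine eq_zero_of_diag_eq_zero ?_ ?_
    · intro σ w
      rw [hS, hS]
      refine ((Equiv.sum_comp σ fun s => η (Function.update w s ⁅x, w s⁆)).symm.trans ?_).symm
      refine Finset.sum_congr rfl fun s _ => ?_
      rw [← hη.symm σ]
      refine congrArg η (funext fun i => ?_)
      by_cases h : i = s
      · subst h
        simp
      · simp [Function.update_of_ne h, Function.update_of_ne (σ.injective.ne h)]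
    · intro v
      rw [hS]
      have hd : ∀ _ : Fin k, MDifferentiableAt 𝓘(ℝ, E) 𝓘(ℝ, E) (adjointOrbit v) (1 : G) := fun _ =>
        ((contMDiff_adjointOrbit v).mdifferentiable (by simp)).mdifferentiableAt
      let ξ : MultilinearMap ℝ (fun _ : Fin k => E) ℝ := η
      have h1 := mvfderiv_multilinear (F := E) ξ hd x
      have h2 : (fun y : G => ξ (fun _ => adjointOrbit v y)) = fun _ => P v := by
        funext y
        exact (hη.diag _).symm.trans (hinv y v)
      have h3 : mvfderiv 𝓘(ℝ, E) (fun y : G => ξ (fun _ => adjointOrbit v y)) 1 x = 0 := by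
        rw [h2, mvfderiv_const]
        rfl
      rw [mfderiv_adjointOrbit, adjointOrbit_one] at h1
      exact h1.symm.trans h3
  rw [this]
  rfl

end Adjoint

/-- A bilinear form, as a multilinear map in two variables. -/
def bilinMultilinear {V : Type*} [AddCommGroup V] [Module ℝ V] (q : LinearMap.BilinForm ℝ V) :
    MultilinearMap ℝ (fun _ : Fin 2 => V) ℝ where
  toFun w := q (w 0) (w 1)
  map_update_add' w i u v := by
    fin_cases i <;> simp
  map_update_smul' w i c v := by
    fin_cases i <;> simp

@[simp]
theorem bilinMultilinear_apply {V : Type*} [AddCommGroup V] [Module ℝ V]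
    (q : LinearMap.BilinForm ℝ V) (w : Fin 2 → V) : bilinMultilinear q w = q (w 0) (w 1) := rfl

/-! ### Compact groups with simple Lie algebra have negative definite Killing form -/

section Average

open MeasureTheory

variable {E : Type*} [NormedAddCommGroup E] [NormedSpace ℝ E] [FiniteDimensional ℝ E]
  {G : Type*} [TopologicalSpace G] [ChartedSpace E G] [Group G]

/-- The standard inner product of two vectors moved by the adjoint action. -/
def coordinateForm (u v : GroupLieAlgebra 𝓘(ℝ, E) G) (g : G) : ℝ :=
  ∑ i, (Module.finBasis ℝ E).repr (adjointOrbit u g) i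
    * (Module.finBasis ℝ E).repr (adjointOrbit v g) i

theorem coordinateForm_add_left (u u' v : GroupLieAlgebra 𝓘(ℝ, E) G) (g : G) :
    coordinateForm (u + u') v g = coordinateForm u v g + coordinateForm u' v g := by
  have : adjointOrbit (u + u') g = adjointOrbit u g + adjointOrbit u' g :=
    map_add (adjointAction g) u u'
  simp only [coordinateForm, this, map_add, Finsupp.add_apply, add_mul, Finset.sum_add_distrib]

theorem coordinateForm_smul_left (c : ℝ) (u v : GroupLieAlgebra 𝓘(ℝ, E) G) (g : G) :
    coordinateForm (c • u) v g = c * coordinateForm u v g := by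
  have : adjointOrbit (c • u) g = c • adjointOrbit u g :=
    map_smul (adjointAction g) c u
  simp only [coordinateForm, this, map_smul, Finsupp.smul_apply, smul_eq_mul, Finset.mul_sum,
    mul_assoc]

theorem coordinateForm_comm (u v : GroupLieAlgebra 𝓘(ℝ, E) G) (g : G) :
    coordinateForm u v g = coordinateForm v u g :=
  Finset.sum_congr rfl fun _ _ => mul_comm _ _

theorem coordinateForm_self_nonneg (u : GroupLieAlgebra 𝓘(ℝ, E) G) (g : G) :
    0 ≤ coordinateForm u u g :=
  Finset.sum_nonneg fun _ _ => mul_self_nonneg _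

theorem coordinateForm_self_one_ne_zero {u : GroupLieAlgebra 𝓘(ℝ, E) G} (hu : u ≠ 0) :
    coordinateForm u u (1 : G) ≠ 0 := by
  intro h
  rw [coordinateForm, Finset.sum_eq_zero_iff_of_nonneg fun _ _ => mul_self_nonneg _] at h
  apply hu
  have h0 : adjointOrbit u (1 : G) = 0 := by
    refine (Module.finBasis ℝ E).repr.map_eq_zero_iff.mp (Finsupp.ext fun i => ?_)
    exact mul_self_eq_zero.mp (h i (Finset.mem_univ i))
  exact (adjointOrbit_one u).symm.trans h0

variable [LieGroup 𝓘(ℝ, E) ∞ G]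

theorem coordinateForm_adjointAction (a : G) (u v : GroupLieAlgebra 𝓘(ℝ, E) G) (g : G) :
    coordinateForm (adjointAction a u) (adjointAction a v) g = coordinateForm u v (g * a) := by
  simp only [coordinateForm, adjointOrbit, adjointAction_mul]

theorem continuous_coordinateForm (u v : GroupLieAlgebra 𝓘(ℝ, E) G) :
    Continuous (coordinateForm u v : G → ℝ) := by
  have hc : ∀ (w : GroupLieAlgebra 𝓘(ℝ, E) G) i,
      Continuous fun g : G => (Module.finBasis ℝ E).repr (adjointOrbit w g) i := fun w i =>
    (LinearMap.continuous_of_finiteDimensional ((Module.finBasis ℝ E).coord i)).comp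
      (contMDiff_adjointOrbit w).continuous
  exact continuous_finsetSum _ fun i _ => (hc u i).mul (hc v i)

variable (E G) in
/-- A compact Lie group carries an inner product on its Lie algebra invariant under the adjoint
action. -/
theorem exists_adjointAction_invariant [T2Space G] [CompactSpace G] :
    ∃ q : LinearMap.BilinForm ℝ (GroupLieAlgebra 𝓘(ℝ, E) G), (∀ u v, q u v = q v u) ∧
      (∀ u ≠ 0, 0 < q u u) ∧ ∀ (a : G) u v, q (adjointAction a u) (adjointAction a v) = q u v := by
  let _ : MeasurableSpace G := borel G
  have : BorelSpace G := ⟨rfl⟩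
  have : IsTopologicalGroup G := topologicalGroup_of_lieGroup 𝓘(ℝ, E) ∞
  let μ : Measure G := Measure.haar
  -- Acting by `a` on the vectors translates `coordinateForm` on the right. Evaluating at `g⁻¹`
  -- turns this into a left translation of `g`, under which the Haar measure is invariant.
  have hcont : ∀ u v : GroupLieAlgebra 𝓘(ℝ, E) G,
      Continuous fun g : G => coordinateForm u v g⁻¹ := fun u v =>
    (continuous_coordinateForm u v).comp continuous_inv
  have hint : ∀ u v : GroupLieAlgebra 𝓘(ℝ, E) G,
      Integrable (fun g : G => coordinateForm u v g⁻¹) μ := fun u v =>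
    (hcont u v).integrable_of_hasCompactSupport (HasCompactSupport.of_compactSpace _)
  have hadd : ∀ u u' v : GroupLieAlgebra 𝓘(ℝ, E) G, ∫ g, coordinateForm (u + u') v g⁻¹ ∂μ
      = ∫ g, coordinateForm u v g⁻¹ ∂μ + ∫ g, coordinateForm u' v g⁻¹ ∂μ := fun u u' v => by
    simp only [coordinateForm_add_left]
    exact integral_add (hint u v) (hint u' v)
  have hsmul : ∀ (c : ℝ) (u v : GroupLieAlgebra 𝓘(ℝ, E) G), ∫ g, coordinateForm (c • u) v g⁻¹ ∂μ
      = c * ∫ g, coordinateForm u v g⁻¹ ∂μ := fun c u v => by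
    simp only [coordinateForm_smul_left]
    exact integral_const_mul c _
  have hcomm : ∀ u v : GroupLieAlgebra 𝓘(ℝ, E) G, ∫ g, coordinateForm u v g⁻¹ ∂μ
      = ∫ g, coordinateForm v u g⁻¹ ∂μ := fun u v => by
    simp only [coordinateForm_comm u v]
  refine ⟨LinearMap.mk₂ ℝ (fun u v => ∫ g, coordinateForm u v g⁻¹ ∂μ) hadd hsmul
    (fun u v v' => ?_) (fun c u v => ?_), ?_, ?_, ?_⟩
  · rw [hcomm, hadd, hcomm v, hcomm v']
  · rw [hcomm, hsmul, hcomm v, smul_eq_mul]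
  · exact hcomm
  · intro u hu
    refine (hcont u u).integral_pos_of_hasCompactSupport_nonneg_nonzero
      (HasCompactSupport.of_compactSpace _) (fun g => coordinateForm_self_nonneg u g⁻¹) (x := 1) ?_
    rw [inv_one]
    exact coordinateForm_self_one_ne_zero hu
  · intro a u v
    simp only [LinearMap.mk₂_apply, coordinateForm_adjointAction]
    rw [← integral_mul_left_eq_self (fun g => coordinateForm u v g⁻¹) a⁻¹]
    simp only [mul_inv_rev, inv_inv]

/-- A form invariant under the adjoint action is infinitesimally invariant. -/
theorem isAdInvariant_of_adjointAction [CompleteSpace E]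
    {q : LinearMap.BilinForm ℝ (GroupLieAlgebra 𝓘(ℝ, E) G)} (hsymm : ∀ u v, q u v = q v u)
    (hq : ∀ (a : G) u v, q (adjointAction a u) (adjointAction a v) = q u v) : IsAdInvariant q := by
  have hη : IsPolarization (bilinMultilinear q) fun v => q v v := by
    refine ⟨fun s w => ?_, fun v => rfl⟩
    simp only [bilinMultilinear_apply]
    have hne : s 0 ≠ s 1 := s.injective.ne (by decide)
    generalize s 0 = a, s 1 = b at hne
    fin_cases a <;> fin_cases b
    · exact absurd rfl hne
    · rfl
    · exact hsymm _ _
    · exact absurd rfl hne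
  intro x u v
  -- The case of degree two, for the quadratic form `v ↦ q v v`.
  have h := sum_map_update_lie hη (fun g v => hq g v v) x ![u, v]
  simpa [Fin.sum_univ_two] using h

theorem negKilling_pos [CompleteSpace E] [T2Space G] [CompactSpace G]
    [LieAlgebra.IsSimple ℝ (GroupLieAlgebra 𝓘(ℝ, E) G)] {x : GroupLieAlgebra 𝓘(ℝ, E) G}
    (hx : x ≠ 0) : 0 < negKilling 𝓘(ℝ, E) G x x := by
  obtain ⟨q, hsymm, hpos, hq⟩ := exists_adjointAction_invariant E G
  have : Module.Finite ℝ (GroupLieAlgebra 𝓘(ℝ, E) G) := inferInstanceAs (Module.Finite ℝ E)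
  exact neg_killingForm_pos (LieAlgebra.center_eq_bot _ _) hsymm hpos
    (isAdInvariant_of_adjointAction hsymm hq) hx

end Average

/-! ### The Levi-Civita connection in the left-invariant frame -/

section Connection

variable {E : Type*} [NormedAddCommGroup E] [NormedSpace ℝ E] [CompleteSpace E]
  {G : Type*} [TopologicalSpace G] [ChartedSpace E G] [Group G] [LieGroup 𝓘(ℝ, E) ∞ G]

theorem killingMetric_apply (x : G) (u v : TangentSpace 𝓘(ℝ, E) x) :
    killingMetric 𝓘(ℝ, E) G x u v
      = negKilling 𝓘(ℝ, E) G (toLieAlgebra x u) (toLieAlgebra x v) := rfl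

theorem negKilling_comm (u v : GroupLieAlgebra 𝓘(ℝ, E) G) :
    negKilling 𝓘(ℝ, E) G u v = negKilling 𝓘(ℝ, E) G v u := neg_killingForm_comm u v

theorem isAdInvariant_negKilling : IsAdInvariant (negKilling 𝓘(ℝ, E) G) :=
  isAdInvariant_neg_killingForm

variable [FiniteDimensional ℝ E]
  {D : CovariantDerivative 𝓘(ℝ, E) E (TangentSpace 𝓘(ℝ, E) : G → Type _)}

/-- Koszul's argument. Let `S` be the deviation from half the bracket. Vanishing torsion makes `S u
w` symmetric; since `h` is constant on left-invariant fields and the Killing form is invariant, `b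
(S u w) z` is skew in `w, z`. Symmetry in one pair and skewness in the next force it to vanish. -/
theorem IsLeviCivita.toLieAlgebra_invariant (hD : IsLeviCivita (killingMetric 𝓘(ℝ, E) G) D)
    (hpos : ∀ u ≠ 0, 0 < negKilling 𝓘(ℝ, E) G u u) (x : G) (u w : GroupLieAlgebra 𝓘(ℝ, E) G) :
    toLieAlgebra x (D (mulInvariantVectorField w) x (mulInvariantVectorField u x))
      = (1 / 2 : ℝ) • ⁅u, w⁆ := by
  set b := negKilling 𝓘(ℝ, E) G with hb
  let S : GroupLieAlgebra 𝓘(ℝ, E) G → GroupLieAlgebra 𝓘(ℝ, E) G → GroupLieAlgebra 𝓘(ℝ, E) G :=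
    fun u w => toLieAlgebra x (D (mulInvariantVectorField w) x (mulInvariantVectorField u x))
      - (1 / 2 : ℝ) • ⁅u, w⁆
  have hS : ∀ u w, toLieAlgebra x (D (mulInvariantVectorField w) x (mulInvariantVectorField u x))
      = S u w + (1 / 2 : ℝ) • ⁅u, w⁆ := fun u w => (sub_add_cancel _ _).symm
  have hsymm : ∀ u w, S u w = S w u := by
    intro u w
    have h1 := D.torsion_eq_zero_iff.mp hD.torsion_free
      (mdifferentiableAt_mulInvariantVectorField u (g := x))
      (mdifferentiableAt_mulInvariantVectorField w (g := x))
    rw [← mulInvariantVector_mlieBracket, ← GroupLieAlgebra.bracket_def] at h1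
    have h2 := congrArg (toLieAlgebra x) h1
    rw [map_sub, toLieAlgebra_mulInvariantVectorField, hS, hS, ← lie_skew w u] at h2
    rw [← sub_eq_zero]
    calc S u w - S w u
        = (S u w + (1 / 2 : ℝ) • ⁅u, w⁆ - (S w u + (1 / 2 : ℝ) • -⁅u, w⁆)) - ⁅u, w⁆ := by module
      _ = 0 := by rw [h2, sub_self]
  have hskew : ∀ u w z, b (S u w) z = - b (S u z) w := by
    intro u w z
    have h1 := hD.metric x (mulInvariantVectorField u x) _ _
      (mdifferentiableAt_mulInvariantVectorField w (g := x))
      (mdifferentiableAt_mulInvariantVectorField z (g := x))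
    simp only [killingMetric_apply, toLieAlgebra_mulInvariantVectorField, hS, mvfderiv_const] at h1
    have h2 := isAdInvariant_negKilling u w z
    rw [← hb] at h1 h2
    have h3 : b w (S u z) = b (S u z) w := negKilling_comm _ _
    simp only [map_add, map_smul, LinearMap.add_apply, LinearMap.smul_apply, smul_eq_mul] at h1
    have h4 : (0 : ℝ) = b (S u w) z + b w (S u z) + (1 / 2) * (b ⁅u, w⁆ z + b w ⁅u, z⁆) := by
      refine Eq.trans h1 ?_
      ring
    rw [h2, h3] at h4
    linarith
  have hzero : ∀ u w z, b (S u w) z = 0 := by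
    intro u w z
    have e1 := hskew u w z
    have e2 := hskew z u w
    have e3 := hskew w z u
    rw [hsymm u z] at e1
    rw [hsymm z w] at e2
    rw [hsymm w u] at e3
    linarith
  have hSz : S u w = 0 := by
    by_contra hne
    exact (hpos _ hne).ne' (hzero u w _)
  rw [hS, hSz, zero_add]

end Connection

/-! ### Vector fields in the left-invariant frame -/

section Bilinear

variable {E : Type*} [NormedAddCommGroup E] [NormedSpace ℝ E] {H : Type*} [TopologicalSpace H]
  {I : ModelWithCorners ℝ E H} {M : Type*} [TopologicalSpace M] [ChartedSpace H M]
  {F F' : Type*} [NormedAddCommGroup F] [NormedSpace ℝ F] [FiniteDimensional ℝ F]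
  [NormedAddCommGroup F'] [NormedSpace ℝ F']

theorem hasMFDerivAt_bilinear (B : F →ₗ[ℝ] F →ₗ[ℝ] F') {f g : M → F} {x : M}
    (hf : MDifferentiableAt I 𝓘(ℝ, F) f x) (hg : MDifferentiableAt I 𝓘(ℝ, F) g x) :
    HasMFDerivAt I 𝓘(ℝ, F') (fun y => B (f y) (g y)) x
      (B.toContinuousBilinearMap.precompR E (f x) (mvfderiv I g x : E →L[ℝ] F)
        + B.toContinuousBilinearMap.precompL E (mvfderiv I f x : E →L[ℝ] F) (g x)) := by
  refine ⟨?_, ?_⟩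
  · exact (B.toContinuousBilinearMap.continuous₂.continuousAt).comp
      (f := fun y => (f y, g y)) (hf.continuousAt.prodMk hg.continuousAt)
  · have := B.toContinuousBilinearMap.hasFDerivWithinAt_of_bilinear
      (hasFDerivWithinAt_of_mdifferentiableAt hf) (hasFDerivWithinAt_of_mdifferentiableAt hg)
    simp only [extChartAt_to_inv] at this
    exact this

theorem mdifferentiableAt_bilinear (B : F →ₗ[ℝ] F →ₗ[ℝ] F') {f g : M → F} {x : M}
    (hf : MDifferentiableAt I 𝓘(ℝ, F) f x) (hg : MDifferentiableAt I 𝓘(ℝ, F) g x) :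
    MDifferentiableAt I 𝓘(ℝ, F') (fun y => B (f y) (g y)) x :=
  (hasMFDerivAt_bilinear B hf hg).mdifferentiableAt

theorem mvfderiv_bilinear (B : F →ₗ[ℝ] F →ₗ[ℝ] F') {f g : M → F} {x : M}
    (hf : MDifferentiableAt I 𝓘(ℝ, F) f x) (hg : MDifferentiableAt I 𝓘(ℝ, F) g x)
    (v : TangentSpace I x) :
    mvfderiv I (fun y => B (f y) (g y)) x v
      = B (f x) (mvfderiv I g x v) + B (mvfderiv I f x v) (g x) :=
  DFunLike.congr_fun (hasMFDerivAt_bilinear B hf hg).mfderiv v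

theorem hasMFDerivAt_linear (A : F →ₗ[ℝ] F') {f : M → F} {x : M}
    (hf : MDifferentiableAt I 𝓘(ℝ, F) f x) :
    HasMFDerivAt I 𝓘(ℝ, F') (fun y => A (f y)) x
      (A.toContinuousLinearMap ∘L (mvfderiv I f x : E →L[ℝ] F)) :=
  ⟨A.toContinuousLinearMap.continuous.continuousAt.comp hf.continuousAt,
    A.toContinuousLinearMap.hasFDerivAt.comp_hasFDerivWithinAt _
      (hasFDerivWithinAt_of_mdifferentiableAt hf)⟩

theorem mdifferentiableAt_linear (A : F →ₗ[ℝ] F') {f : M → F} {x : M}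
    (hf : MDifferentiableAt I 𝓘(ℝ, F) f x) :
    MDifferentiableAt I 𝓘(ℝ, F') (fun y => A (f y)) x :=
  (hasMFDerivAt_linear A hf).mdifferentiableAt

theorem mvfderiv_linear (A : F →ₗ[ℝ] F') {f : M → F} {x : M}
    (hf : MDifferentiableAt I 𝓘(ℝ, F) f x) (v : TangentSpace I x) :
    mvfderiv I (fun y => A (f y)) x v = A (mvfderiv I f x v) :=
  DFunLike.congr_fun (hasMFDerivAt_linear A hf).mfderiv v

end Bilinear

section Sum

variable {E : Type*} [NormedAddCommGroup E] [NormedSpace ℝ E]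

theorem connection_sum {H : Type*} [TopologicalSpace H] {I : ModelWithCorners ℝ E H} {M : Type*}
    [TopologicalSpace M] [ChartedSpace H M] [IsManifold I ∞ M]
    (D : CovariantDerivative I E (TangentSpace I : M → Type _)) {ι : Type*} (s : Finset ι)
    {σ : ι → ∀ g : M, TangentSpace I g} {x : M}
    (hσ : ∀ i, MDifferentiableAt I I.tangent
      (fun g => (σ i g : TangentBundle I M)) x) :
    D (∑ i ∈ s, σ i) x = ∑ i ∈ s, D (σ i) x := by
  classical
  induction s using Finset.induction_on with
  | empty => simp
  | insert a s ha ih =>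
    rw [Finset.sum_insert ha, Finset.sum_insert ha, ← ih]
    refine D.isCovariantDerivativeOnUniv.add (hσ a) ?_
    have := MDifferentiableAt.sum_section (s := s) fun i _ => hσ i
    simpa only [Finset.sum_apply] using this

end Sum

section Frame

variable {E : Type*} [NormedAddCommGroup E] [NormedSpace ℝ E]
  {G : Type*} [TopologicalSpace G] [ChartedSpace E G] [Group G] [LieGroup 𝓘(ℝ, E) ∞ G]

/-- The vector field with given components in the left trivialization. -/
def ofComponents (f : G → E) (g : G) : TangentSpace 𝓘(ℝ, E) g :=
  mulInvariantVectorField (I := 𝓘(ℝ, E)) (f g) g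

theorem ofComponents_components (X : ∀ g : G, TangentSpace 𝓘(ℝ, E) g) :
    ofComponents (components X) = X :=
  funext fun g => mulInvariantVectorField_toLieAlgebra g (X g)

variable [FiniteDimensional ℝ E]

/-- The coefficients of a map in the standard basis. -/
def coefficient {G : Type*} (f : G → E) (i : Fin (Module.finrank ℝ E)) (g : G) : ℝ :=
  (Module.finBasis ℝ E).coord i (f g)

variable (E G) in
/-- The standard basis of the Lie algebra. -/
def lieBasis : Module.Basis (Fin (Module.finrank ℝ E)) ℝ (GroupLieAlgebra 𝓘(ℝ, E) G) :=
  Module.finBasis ℝ E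

variable (E G) in
/-- The standard left-invariant frame. -/
def invariantFrame (i : Fin (Module.finrank ℝ E)) (g : G) : TangentSpace 𝓘(ℝ, E) g :=
  mulInvariantVectorField (lieBasis E G i) g

theorem ofComponents_eq_sum (f : G → E) :
    ofComponents f = ∑ i, coefficient f i • invariantFrame E G i := by
  funext g
  apply (leftTrivialization g).injective
  have h1 : leftTrivialization g (ofComponents f g) = f g :=
    toLieAlgebra_mulInvariantVectorField g (f g)
  have h2 : ∀ i, leftTrivialization g (invariantFrame E G i g) = Module.finBasis ℝ E i := fun i =>
    toLieAlgebra_mulInvariantVectorField g _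
  rw [Finset.sum_apply, map_sum, h1]
  simp only [Pi.smul_apply', map_smul, h2]
  exact ((Module.finBasis ℝ E).sum_repr (f g)).symm

theorem mdifferentiableAt_coefficient {G : Type*} [TopologicalSpace G] [ChartedSpace E G]
    {f : G → E} {x : G}
    (hf : MDifferentiableAt 𝓘(ℝ, E) 𝓘(ℝ, E) f x) (i : Fin (Module.finrank ℝ E)) :
    MDifferentiableAt 𝓘(ℝ, E) 𝓘(ℝ, ℝ) (coefficient f i) x :=
  mdifferentiableAt_linear ((Module.finBasis ℝ E).coord i) hf

theorem mdifferentiableAt_invariantFrame (i : Fin (Module.finrank ℝ E)) (x : G) :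
    MDifferentiableAt 𝓘(ℝ, E) 𝓘(ℝ, E).tangent
      (fun g => (invariantFrame E G i g : TangentBundle 𝓘(ℝ, E) G)) x :=
  mdifferentiableAt_mulInvariantVectorField _

theorem mdifferentiableAt_ofComponents {f : G → E} {x : G}
    (hf : MDifferentiableAt 𝓘(ℝ, E) 𝓘(ℝ, E) f x) :
    MDifferentiableAt 𝓘(ℝ, E) 𝓘(ℝ, E).tangent
      (fun g => (ofComponents f g : TangentBundle 𝓘(ℝ, E) G)) x := by
  rw [ofComponents_eq_sum]
  simp only [Finset.sum_apply]
  exact MDifferentiableAt.sum_section fun i _ =>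
    (mdifferentiableAt_coefficient hf i).smul_section (mdifferentiableAt_invariantFrame i x)

variable [CompleteSpace E]

/-- The derivative of the components of a vector field in the left trivialization. -/
def componentsDeriv (W : ∀ g : G, TangentSpace 𝓘(ℝ, E) g) (x : G) (v : TangentSpace 𝓘(ℝ, E) x) :
    GroupLieAlgebra 𝓘(ℝ, E) G :=
  mvfderiv 𝓘(ℝ, E) (components W) x v

/-- Expand `W` in the left-invariant frame: the Leibniz rule differentiates the coefficients, and
each frame field contributes half a bracket. -/
theorem IsLeviCivita.toLieAlgebra_connection
    {D : CovariantDerivative 𝓘(ℝ, E) E (TangentSpace 𝓘(ℝ, E) : G → Type _)}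
    (hD : IsLeviCivita (killingMetric 𝓘(ℝ, E) G) D)
    (hpos : ∀ u ≠ 0, 0 < negKilling 𝓘(ℝ, E) G u u) {W : ∀ g : G, TangentSpace 𝓘(ℝ, E) g} {x : G}
    (hW : MDifferentiableAt 𝓘(ℝ, E) 𝓘(ℝ, E).tangent
      (fun g => (W g : TangentBundle 𝓘(ℝ, E) G)) x) (v : TangentSpace 𝓘(ℝ, E) x) :
    toLieAlgebra x (D W x v)
      = componentsDeriv W x v + (1 / 2 : ℝ) • ⁅toLieAlgebra x v, toLieAlgebra x (W x)⁆ := by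
  have hf := mdifferentiableAt_components hW
  set f := components W with hfdef
  have hfx : ∑ i, coefficient f i x • lieBasis E G i
      = toLieAlgebra x (W x) := (Module.finBasis ℝ E).sum_repr (f x)
  have hdf : ∑ i, mvfderiv 𝓘(ℝ, E) (coefficient f i) x v
      • lieBasis E G i = componentsDeriv W x v := by
    refine Eq.trans (Finset.sum_congr rfl fun i _ => ?_)
      ((Module.finBasis ℝ E).sum_repr (mvfderiv 𝓘(ℝ, E) f x v))
    rw [show mvfderiv 𝓘(ℝ, E) (coefficient f i) x v
      = (Module.finBasis ℝ E).coord i (mvfderiv 𝓘(ℝ, E) f x v) from mvfderiv_linear _ hf v]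
    rfl
  have hframe : ∀ i, toLieAlgebra x (invariantFrame E G i x)
      = lieBasis E G i := fun i =>
    toLieAlgebra_mulInvariantVectorField x _
  have hDframe : ∀ i, toLieAlgebra x (D (invariantFrame E G i) x v)
      = (1 / 2 : ℝ) • ⁅toLieAlgebra x v, lieBasis E G i⁆ := by
    intro i
    have := hD.toLieAlgebra_invariant hpos x (toLieAlgebra x v) (lieBasis E G i)
    rwa [mulInvariantVectorField_toLieAlgebra] at this
  have hWsum : W = ∑ i, coefficient f i • invariantFrame E G i := by
    rw [← ofComponents_eq_sum, hfdef, ofComponents_components]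
  have hterm : ∀ i, D (coefficient f i • invariantFrame E G i) x
      = coefficient f i x • D (invariantFrame E G i) x
        + (mvfderiv 𝓘(ℝ, E) (coefficient f i) x).smulRight (invariantFrame E G i x) := fun i =>
    D.isCovariantDerivativeOnUniv.leibniz (mdifferentiableAt_invariantFrame i x)
      (mdifferentiableAt_coefficient hf i)
  rw [← hdf, ← hfx, lie_sum, Finset.smul_sum, ← Finset.sum_add_distrib]
  conv_lhs => rw [hWsum]
  rw [connection_sum D _ fun i => (mdifferentiableAt_coefficient hf i).smul_section
    (mdifferentiableAt_invariantFrame i x), sum_apply, map_sum]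
  refine Finset.sum_congr rfl fun i _ => ?_
  rw [hterm, add_apply, smul_apply, ContinuousLinearMap.smulRight_apply, map_add, map_smul,
    map_smul, hframe, hDframe, lie_smul, smul_comm, add_comm]

end Frame

/-! ### Invariant tensors are parallel -/

section Parallel

variable {E : Type*} [NormedAddCommGroup E] [NormedSpace ℝ E] [FiniteDimensional ℝ E]
  [CompleteSpace E]
  {G : Type*} [TopologicalSpace G] [ChartedSpace E G] [Group G] [LieGroup 𝓘(ℝ, E) ∞ G]

/-- In the left trivialization the tensor has constant coefficients, so the derivatives of the
components of the extended fields cancel. What remains is `-1/2` times the sum that infinitesimal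
invariance annihilates. -/
theorem IsLeviCivita.covDeriv_invariantTensor
    {D : CovariantDerivative 𝓘(ℝ, E) E (TangentSpace 𝓘(ℝ, E) : G → Type _)}
    (hD : IsLeviCivita (killingMetric 𝓘(ℝ, E) G) D)
    (hpos : ∀ u ≠ 0, 0 < negKilling 𝓘(ℝ, E) G u u) {k : ℕ}
    {η : MultilinearMap ℝ (fun _ : Fin k => GroupLieAlgebra 𝓘(ℝ, E) G) ℝ}
    (hη : ∀ (x : GroupLieAlgebra 𝓘(ℝ, E) G) (w : Fin k → GroupLieAlgebra 𝓘(ℝ, E) G),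
      ∑ s, η (Function.update w s ⁅x, w s⁆) = 0)
    (x : G) (v : TangentSpace 𝓘(ℝ, E) x) (w : Fin k → TangentSpace 𝓘(ℝ, E) x) :
    covDeriv D (invariantTensor η) x v w = 0 := by
  set W : Fin k → ∀ y : G, TangentSpace 𝓘(ℝ, E) y := fun i => FiberBundle.extend E (w i) with hW
  have hWx : ∀ i, W i x = w i := fun i => FiberBundle.extend_apply_self E (w i)
  have hWd : ∀ i, MDifferentiableAt 𝓘(ℝ, E) 𝓘(ℝ, E).tangent
      (fun g => (W i g : TangentBundle 𝓘(ℝ, E) G)) x := fun i =>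
    FiberBundle.mdifferentiableAt_extend 𝓘(ℝ, E) E (w i)
  have hcx : ∀ i, components (W i) x = toLieAlgebra x (w i) := fun i =>
    congrArg (toLieAlgebra x) (hWx i)
  have h1 : mvfderiv 𝓘(ℝ, E) (fun y => invariantTensor η y (fun i => W i y)) x v
      = ∑ i, η (Function.update (fun j => toLieAlgebra x (w j)) i (componentsDeriv (W i) x v)) := by
    let ξ : MultilinearMap ℝ (fun _ : Fin k => E) ℝ := η
    have := mvfderiv_multilinear (F := E) ξ (fun i => mdifferentiableAt_components (hWd i)) v
    simp only [hcx] at this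
    exact this
  have h2 : ∀ i, invariantTensor η x (Function.update w i (D (W i) x v))
      = η (Function.update (fun j => toLieAlgebra x (w j)) i (componentsDeriv (W i) x v))
        + (1 / 2) * η (Function.update (fun j => toLieAlgebra x (w j)) i
          ⁅toLieAlgebra x v, toLieAlgebra x (w i)⁆) := by
    intro i
    have e : invariantTensor η x (Function.update w i (D (W i) x v))
        = η (Function.update (fun j => toLieAlgebra x (w j)) i
          (toLieAlgebra x (D (W i) x v))) := by
      refine congrArg η (funext fun j => ?_)
      by_cases h : j = i
      · subst h
        simp
      · simp [h]
    rw [e, hD.toLieAlgebra_connection hpos (hWd i), hWx, MultilinearMap.map_update_add,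
      MultilinearMap.map_update_smul, smul_eq_mul]
  have h3 := hη (toLieAlgebra x v) (fun j => toLieAlgebra x (w j))
  change mvfderiv 𝓘(ℝ, E) (fun y => invariantTensor η y (fun i => W i y)) x v
    - ∑ i, invariantTensor η x (Function.update w i (D (W i) x v)) = 0
  rw [h1, Finset.sum_congr rfl fun i _ => h2 i, Finset.sum_add_distrib, ← Finset.mul_sum, h3]
  ring

end Parallel

/-! ### Coordinate vector fields -/

section Coordinates

open Filter Topology VectorField

variable {E : Type*} [NormedAddCommGroup E] [NormedSpace ℝ E]
  {M : Type*} [TopologicalSpace M] [ChartedSpace E M] [IsManifold 𝓘(ℝ, E) ∞ M]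

/-- Near the base point, the extension of a tangent vector is a coordinate vector field. -/
theorem eventually_extend_eq {x : M} (v : TangentSpace 𝓘(ℝ, E) x) :
    ∀ᶠ y in 𝓝 x, FiberBundle.extend E v y
      = mfderiv 𝓘(ℝ, E) 𝓘(ℝ, E) (extChartAt 𝓘(ℝ, E) x).symm (extChartAt 𝓘(ℝ, E) x y) v := by
  filter_upwards [chart_source_mem_nhds E x] with y hy
  have h1 := TangentBundle.symmL_trivializationAt (I := 𝓘(ℝ, E)) hy
  rw [ModelWithCorners.range_eq_univ, mfderivWithin_univ] at h1
  have h2 : (trivializationAt E (TangentSpace 𝓘(ℝ, E)) x ⟨x, v⟩).2 = v := by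
    rw [TangentBundle.trivializationAt_apply]
    exact tangentCoordChange_self (I := 𝓘(ℝ, E)) (x := x) (z := x) (v := v)
      (mem_extChartAt_source x)
  have h3 : FiberBundle.extend E v y
      = (trivializationAt E (TangentSpace 𝓘(ℝ, E)) x).symm y v :=
    congrArg (fun w : E => (trivializationAt E (TangentSpace 𝓘(ℝ, E)) x).symm y w) h2
  refine h3.trans (Eq.trans ?_ (DFunLike.congr_fun h1 v))
  exact (Bundle.Trivialization.symmL_apply (R := ℝ) (F := E)
    (trivializationAt E (TangentSpace 𝓘(ℝ, E)) x) hy v).symm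

theorem eventually_mvfderiv_extend {F : Type*} [NormedAddCommGroup F] [NormedSpace ℝ F] {g : M → F}
    {x : M} (hg : ContMDiffAt 𝓘(ℝ, E) 𝓘(ℝ, F) 1 g x) (v : TangentSpace 𝓘(ℝ, E) x) :
    ∀ᶠ y in 𝓝 x, mvfderiv 𝓘(ℝ, E) g y (FiberBundle.extend E v y)
      = fderiv ℝ (fun a => g ((extChartAt 𝓘(ℝ, E) x).symm a)) (extChartAt 𝓘(ℝ, E) x y) v := by
  filter_upwards [eventually_extend_eq v, extChartAt_source_mem_nhds (I := 𝓘(ℝ, E)) x,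
    (contMDiffAt_iff_contMDiffAt_nhds (by simp)).mp hg] with y hy hys hgy
  have hinv : (extChartAt 𝓘(ℝ, E) x).symm (extChartAt 𝓘(ℝ, E) x y) = y :=
    (extChartAt 𝓘(ℝ, E) x).left_inv hys
  have hgd : MDifferentiableAt 𝓘(ℝ, E) 𝓘(ℝ, F) g
      ((extChartAt 𝓘(ℝ, E) x).symm (extChartAt 𝓘(ℝ, E) x y)) := by
    rw [hinv]
    exact hgy.mdifferentiableAt (by simp)
  have hsd : MDifferentiableAt 𝓘(ℝ, E) 𝓘(ℝ, E) (extChartAt 𝓘(ℝ, E) x).symm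
      (extChartAt 𝓘(ℝ, E) x y) := by
    refine ((contMDiffOn_extChartAt_symm (n := ∞) x).contMDiffAt
      (extChartAt_target_mem_nhds' ?_)).mdifferentiableAt (by simp)
    exact (extChartAt 𝓘(ℝ, E) x).map_source hys
  have hcomp := DFunLike.congr_fun (mfderiv_comp (extChartAt 𝓘(ℝ, E) x y) hgd hsd) v
  rw [mfderiv_eq_fderiv] at hcomp
  have hpt : ∀ z w : M, z = w → ∀ a : E, (mfderiv 𝓘(ℝ, E) 𝓘(ℝ, F) g z a : F)
      = mfderiv 𝓘(ℝ, E) 𝓘(ℝ, F) g w a := by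
    rintro z _ rfl a
    rfl
  rw [hy]
  refine Eq.trans ?_ hcomp.symm
  exact (hpt _ _ hinv _).symm

theorem contDiffAt_chart {F : Type*} [NormedAddCommGroup F] [NormedSpace ℝ F]
    {g : M → F} {x : M} (hg : ContMDiffAt 𝓘(ℝ, E) 𝓘(ℝ, F) 2 g x) :
    ContDiffAt ℝ 2 (fun a => g ((extChartAt 𝓘(ℝ, E) x).symm a)) (extChartAt 𝓘(ℝ, E) x x) := by
  rw [← contMDiffAt_iff_contDiffAt]
  refine ContMDiffAt.comp (extChartAt 𝓘(ℝ, E) x x) (g := g) ?_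
    ((contMDiffOn_extChartAt_symm (n := 2) x).contMDiffAt (extChartAt_target_mem_nhds x))
  rwa [extChartAt_to_inv]

/-- The second derivative along coordinate vector fields is the second derivative in the chart. -/
theorem hasMFDerivAt_mvfderiv_extend {F : Type*} [NormedAddCommGroup F] [NormedSpace ℝ F]
    {g : M → F} {x : M} (hg : ContMDiffAt 𝓘(ℝ, E) 𝓘(ℝ, F) 2 g x) (v : TangentSpace 𝓘(ℝ, E) x) :
    HasMFDerivAt 𝓘(ℝ, E) 𝓘(ℝ, F) (fun y => mvfderiv 𝓘(ℝ, E) g y (FiberBundle.extend E v y)) x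
      ((fderiv ℝ (fderiv ℝ (fun a => g ((extChartAt 𝓘(ℝ, E) x).symm a)))
        (extChartAt 𝓘(ℝ, E) x x)).flip v) := by
  have hd : DifferentiableAt ℝ (fderiv ℝ (fun a => g ((extChartAt 𝓘(ℝ, E) x).symm a)))
      (extChartAt 𝓘(ℝ, E) x x) :=
    ((contDiffAt_chart hg).fderiv_right (m := 1) (by norm_num)).differentiableAt (by norm_num)
  have hK := (hd.hasFDerivAt.clm_apply (hasFDerivAt_const (v : E) _)).hasMFDerivAt
  have hφ := (mdifferentiableAt_extChartAt (I := 𝓘(ℝ, E)) (mem_chart_source E x)).hasMFDerivAt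
  rw [mfderiv_extChartAt_self] at hφ
  have hc := (hK.comp x hφ).congr_of_eventuallyEq
    (eventually_mvfderiv_extend (hg.of_le (by norm_num)) v)
  refine hc.congr_mfderiv ?_
  have hflip : ∀ (L : E →L[ℝ] E →L[ℝ] F) (p : E →L[ℝ] F) (q : E),
      (p.comp (0 : E →L[ℝ] E) + L.flip q).comp (ContinuousLinearMap.id ℝ E) = L.flip q :=
    fun L p q => by simp
  exact hflip _ _ v

theorem mvfderiv_mvfderiv_extend_comm {F : Type*} [NormedAddCommGroup F] [NormedSpace ℝ F]
    {g : M → F} {x : M} (hg : ContMDiffAt 𝓘(ℝ, E) 𝓘(ℝ, F) 2 g x) (u v : TangentSpace 𝓘(ℝ, E) x) :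
    mvfderiv 𝓘(ℝ, E) (fun y => mvfderiv 𝓘(ℝ, E) g y (FiberBundle.extend E v y)) x u
      = mvfderiv 𝓘(ℝ, E) (fun y => mvfderiv 𝓘(ℝ, E) g y (FiberBundle.extend E u y)) x v := by
  have hsymm : IsSymmSndFDerivAt ℝ (fun a => g ((extChartAt 𝓘(ℝ, E) x).symm a))
      (extChartAt 𝓘(ℝ, E) x x) := (contDiffAt_chart hg).isSymmSndFDerivAt (by simp)
  refine (DFunLike.congr_fun (hasMFDerivAt_mvfderiv_extend hg v).mfderiv u).trans
    (Eq.trans ?_ (DFunLike.congr_fun (hasMFDerivAt_mvfderiv_extend hg u).mfderiv v).symm)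
  exact hsymm u v

/-- In the chart at `x` both extensions are constant fields near the base point. -/
theorem mlieBracket_extend [CompleteSpace E] {x : M} (u v : TangentSpace 𝓘(ℝ, E) x) :
    mlieBracket 𝓘(ℝ, E) (FiberBundle.extend E u) (FiberBundle.extend E v) x = 0 := by
  have hpull : ∀ w : TangentSpace 𝓘(ℝ, E) x, mpullbackWithin 𝓘(ℝ, E) 𝓘(ℝ, E)
      (extChartAt 𝓘(ℝ, E) x).symm (FiberBundle.extend E w) Set.univ
      =ᶠ[𝓝 (extChartAt 𝓘(ℝ, E) x x)] fun _ => w := by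
    intro w
    have ht : Tendsto (extChartAt 𝓘(ℝ, E) x).symm (𝓝 (extChartAt 𝓘(ℝ, E) x x)) (𝓝 x) := by
      have := continuousAt_extChartAt_symm (I := 𝓘(ℝ, E)) x
      rwa [ContinuousAt, extChartAt_to_inv] at this
    filter_upwards [ht.eventually (eventually_extend_eq w),
      extChartAt_target_mem_nhds (I := 𝓘(ℝ, E)) x] with a ha hat
    rw [(extChartAt 𝓘(ℝ, E) x).right_inv hat] at ha
    have i1 := mfderiv_extChartAt_comp_mfderivWithin_extChartAt_symm (I := 𝓘(ℝ, E)) hat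
    have i2 := mfderivWithin_extChartAt_symm_comp_mfderiv_extChartAt (I := 𝓘(ℝ, E)) hat
    rw [ModelWithCorners.range_eq_univ] at i1 i2
    rw [mpullbackWithin_apply, ContinuousLinearMap.inverse_eq i2 i1, ha]
    rw [mfderivWithin_univ] at i1
    exact DFunLike.congr_fun i1 w
  rw [← mlieBracketWithin_univ, mlieBracketWithin_apply]
  refine Eq.trans (congrArg _ ?_) (map_zero _)
  rw [ModelWithCorners.range_eq_univ, Set.preimage_univ, Set.inter_univ]
  refine (congrFun (lieBracketWithin_univ (𝕜 := ℝ) (E := E)) _).trans ?_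
  refine ((hpull u).lieBracket_vectorField_eq (hpull v)).trans ?_
  have hconst : ∀ p q a : E, lieBracket ℝ (fun _ : E => p) (fun _ : E => q) a = 0 := by
    simp [lieBracket]
  exact hconst u v _

end Coordinates

/-! ### Curvature -/

section Curvature

open Filter Topology VectorField

/-- Half the Lie bracket, as a bilinear map. -/
def halfLie (𝔤 : Type*) [LieRing 𝔤] [LieAlgebra ℝ 𝔤] : 𝔤 →ₗ[ℝ] 𝔤 →ₗ[ℝ] 𝔤 :=
  LinearMap.mk₂ ℝ (fun u v => (1 / 2 : ℝ) • ⁅u, v⁆)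
    (fun u u' v => by rw [add_lie, smul_add]) (fun c u v => by rw [smul_lie, smul_comm])
    (fun u v v' => by rw [lie_add, smul_add]) (fun c u v => by rw [lie_smul, smul_comm])

variable {E : Type*} [NormedAddCommGroup E] [NormedSpace ℝ E]
  {G : Type*} [TopologicalSpace G] [ChartedSpace E G] [Group G] [LieGroup 𝓘(ℝ, E) ∞ G]

/-- The second derivative, along extensions of `u` and `v`, of the components of an extension
of `w`. -/
def componentsDeriv₂ {x : G} (w u v : TangentSpace 𝓘(ℝ, E) x) : GroupLieAlgebra 𝓘(ℝ, E) G :=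
  mvfderiv 𝓘(ℝ, E) (fun y => mvfderiv 𝓘(ℝ, E) (components (FiberBundle.extend E w)) y
    (FiberBundle.extend E v y)) x u

theorem componentsDeriv₂_comm {x : G} (w u v : TangentSpace 𝓘(ℝ, E) x) :
    componentsDeriv₂ w u v = componentsDeriv₂ w v u :=
  mvfderiv_mvfderiv_extend_comm (contMDiffAt_components ENat.LEInfty.out
    (FiberBundle.contMDiffAt_extend (k := 2) 𝓘(ℝ, E) E w)) u v

variable [CompleteSpace E]

variable (E G) in
/-- Half the Lie bracket, on the model space. -/
def halfBracket : E →ₗ[ℝ] E →ₗ[ℝ] E :=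
  halfLie (GroupLieAlgebra 𝓘(ℝ, E) G)

variable [FiniteDimensional ℝ E]
  {D : CovariantDerivative 𝓘(ℝ, E) E (TangentSpace 𝓘(ℝ, E) : G → Type _)}

theorem IsLeviCivita.toLieAlgebra_connection_connection
    (hD : IsLeviCivita (killingMetric 𝓘(ℝ, E) G) D)
    (hpos : ∀ u ≠ 0, 0 < negKilling 𝓘(ℝ, E) G u u) {x : G}
    (u v w : TangentSpace 𝓘(ℝ, E) x) :
    toLieAlgebra x (D (fun y => D (FiberBundle.extend E w) y (FiberBundle.extend E v y)) x u)
      = componentsDeriv₂ w u v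
        + ((1 / 2 : ℝ) • ⁅toLieAlgebra x v, componentsDeriv (FiberBundle.extend E w) x u⁆
          + (1 / 2 : ℝ) • ⁅componentsDeriv (FiberBundle.extend E v) x u, toLieAlgebra x w⁆)
        + (1 / 2 : ℝ) • ⁅toLieAlgebra x u, componentsDeriv (FiberBundle.extend E w) x v
          + (1 / 2 : ℝ) • ⁅toLieAlgebra x v, toLieAlgebra x w⁆⁆ := by
  set W : ∀ y : G, TangentSpace 𝓘(ℝ, E) y := FiberBundle.extend E w with hW
  set V : ∀ y : G, TangentSpace 𝓘(ℝ, E) y := FiberBundle.extend E v with hV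
  have hWx : W x = w := FiberBundle.extend_apply_self E w
  have hVx : V x = v := FiberBundle.extend_apply_self E v
  have hWd := FiberBundle.mdifferentiableAt_extend 𝓘(ℝ, E) E w
  have hVd := FiberBundle.mdifferentiableAt_extend 𝓘(ℝ, E) E v
  rw [← hW] at hWd
  rw [← hV] at hVd
  have hWs : ContMDiffAt 𝓘(ℝ, E) 𝓘(ℝ, E) 2 (components W) x :=
    contMDiffAt_components ENat.LEInfty.out
      (FiberBundle.contMDiffAt_extend (k := 2) 𝓘(ℝ, E) E w)
  let A : G → E := fun y => mvfderiv 𝓘(ℝ, E) (components W) y (V y)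
    + halfBracket E G (components V y) (components W y)
  have hsec : MDifferentiableAt 𝓘(ℝ, E) 𝓘(ℝ, E)
      (fun y => mvfderiv 𝓘(ℝ, E) (components W) y (V y)) x :=
    (hasMFDerivAt_mvfderiv_extend hWs v).mdifferentiableAt
  have hVc := mdifferentiableAt_components hVd
  have hWc := mdifferentiableAt_components hWd
  have hbil := mdifferentiableAt_bilinear (halfBracket E G) hVc hWc
  have hA : MDifferentiableAt 𝓘(ℝ, E) 𝓘(ℝ, E) A x := hsec.add hbil
  -- The inner derivative is differentiated again, so its formula is needed on a neighbourhood of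
  -- `x`, on which the extension of `w` is differentiable.
  have hcomp : ∀ᶠ y in 𝓝 x, (fun y => D W y (V y)) y = ofComponents A y := by
    obtain ⟨s, hs, hsW⟩ := FiberBundle.exists_mdifferentiableOn_extend 𝓘(ℝ, E) E w
    filter_upwards [eventually_mem_nhds_iff.mpr hs] with y hy
    apply (leftTrivialization y).injective
    refine (hD.toLieAlgebra_connection hpos (hsW.mdifferentiableAt hy) (V y)).trans ?_
    refine Eq.trans ?_ (?_ : A y = _)
    · rfl
    exact (toLieAlgebra_mulInvariantVectorField y (A y)).symm
  have hcong : (fun y => ((fun y => D W y (V y)) y : TangentBundle 𝓘(ℝ, E) G))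
      =ᶠ[𝓝 x] fun y => (ofComponents A y : TangentBundle 𝓘(ℝ, E) G) :=
    hcomp.mono fun y hy => congrArg _ hy
  have hDV := (mdifferentiableAt_ofComponents hA).congr_of_eventuallyEq hcong
  rw [hD.toLieAlgebra_connection hpos hDV, hD.toLieAlgebra_connection hpos hWd, hVx, hWx]
  refine congrArg (· + _) ?_
  have hcA : components (fun y => D W y (V y)) =ᶠ[𝓝 x] A :=
    hcomp.mono fun y hy => (congrArg (toLieAlgebra y) hy).trans
      (toLieAlgebra_mulInvariantVectorField y (A y))
  have h1 : mvfderiv 𝓘(ℝ, E) (components (fun y => D W y (V y))) x u = mvfderiv 𝓘(ℝ, E) A x u :=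
    DFunLike.congr_fun hcA.mfderiv_eq u
  refine h1.trans ?_
  refine (DFunLike.congr_fun (mvfderiv_add hsec hbil) u).trans ?_
  refine congrArg (fun z : GroupLieAlgebra 𝓘(ℝ, E) G => componentsDeriv₂ w u v + z) ?_
  refine (mvfderiv_bilinear (halfBracket E G) hVc hWc u).trans ?_
  have e1 : components V x = toLieAlgebra x v := congrArg (toLieAlgebra x) hVx
  have e2 : components W x = toLieAlgebra x w := congrArg (toLieAlgebra x) hWx
  rw [e1, e2]
  rfl

/-- The extensions are coordinate fields, not left-invariant ones. Their bracket vanishes, the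
second derivatives of components are symmetric, and the terms in `dW` cancel. Vanishing torsion
gives `dV u - dU v = -[u, v]`, contributing `-1/2`; the Jacobi identity contributes `1/4`, leaving
`-1/4`. -/
theorem IsLeviCivita.toLieAlgebra_curvature
    (hD : IsLeviCivita (killingMetric 𝓘(ℝ, E) G) D)
    (hpos : ∀ u ≠ 0, 0 < negKilling 𝓘(ℝ, E) G u u) (x : G) (u v w : TangentSpace 𝓘(ℝ, E) x) :
    toLieAlgebra x (curvature D x u v w)
      = -(1 / 4 : ℝ) • ⁅⁅toLieAlgebra x u, toLieAlgebra x v⁆, toLieAlgebra x w⁆ := by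
  have hUd := FiberBundle.mdifferentiableAt_extend 𝓘(ℝ, E) E u
  have hVd := FiberBundle.mdifferentiableAt_extend 𝓘(ℝ, E) E v
  have htor := D.torsion_eq_zero_iff.mp hD.torsion_free hUd hVd
  rw [mlieBracket_extend] at htor
  have htor' := congrArg (toLieAlgebra x) htor
  rw [map_sub, map_zero, hD.toLieAlgebra_connection hpos hUd,
    hD.toLieAlgebra_connection hpos hVd, FiberBundle.extend_apply_self,
    FiberBundle.extend_apply_self] at htor'
  have hc : curvature D x u v w
      = D (fun y => D (FiberBundle.extend E w) y (FiberBundle.extend E v y)) x u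
        - D (fun y => D (FiberBundle.extend E w) y (FiberBundle.extend E u y)) x v := by
    unfold curvature
    simp only [mlieBracket_extend, map_zero, sub_zero]
  rw [hc, map_sub, hD.toLieAlgebra_connection_connection hpos,
    hD.toLieAlgebra_connection_connection hpos, componentsDeriv₂_comm w v u]
  set u' := toLieAlgebra x u
  set v' := toLieAlgebra x v
  set w' := toLieAlgebra x w
  set dU := componentsDeriv (FiberBundle.extend E u) x
  set dV := componentsDeriv (FiberBundle.extend E v) x
  set dW := componentsDeriv (FiberBundle.extend E w) x
  have hUV : dV u - dU v = - ⁅u', v'⁆ := by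
    rw [← lie_skew u' v'] at htor'
    rw [← sub_eq_zero, ← htor', ← lie_skew u' v']
    module
  have h1 : ⁅dV u, w'⁆ - ⁅dU v, w'⁆ = - ⁅⁅u', v'⁆, w'⁆ := by
    rw [← sub_lie, hUV, neg_lie]
  have h2 : ⁅u', ⁅v', w'⁆⁆ - ⁅v', ⁅u', w'⁆⁆ = ⁅⁅u', v'⁆, w'⁆ := (lie_lie u' v' w').symm
  simp only [lie_add, lie_smul]
  calc _ = (1 / 2 : ℝ) • (⁅dV u, w'⁆ - ⁅dU v, w'⁆)
        + (1 / 4 : ℝ) • (⁅u', ⁅v', w'⁆⁆ - ⁅v', ⁅u', w'⁆⁆) := by module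
    _ = -(1 / 4 : ℝ) • ⁅⁅u', v'⁆, w'⁆ := by
      rw [h1, h2]
      module

end Curvature

/-! ### Ricci curvature and smoothness -/

section Geometry

/-- A multilinear map, as a bilinear form in its first two arguments. -/
def firstTwo {V : Type*} [AddCommGroup V] [Module ℝ V] {m : ℕ}
    (α : MultilinearMap ℝ (fun _ : Fin (m + 2) => V) ℝ) (w : Fin m → V) :
    LinearMap.BilinForm ℝ V :=
  LinearMap.mk₂ ℝ (fun u v => (α.curryLeft u).curryLeft v w)
    (fun u u' v => by rw [map_add]; rfl) (fun c u v => by rw [map_smul]; rfl)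
    (fun u v v' => by rw [map_add]; rfl) (fun c u v => by rw [map_smul]; rfl)

theorem firstTwo_apply {V : Type*} [AddCommGroup V] [Module ℝ V] {m : ℕ}
    (α : MultilinearMap ℝ (fun _ : Fin (m + 2) => V) ℝ) (w : Fin m → V) (u v : V) :
    firstTwo α w u v = α (Matrix.vecCons u (Matrix.vecCons v w)) := rfl

variable {E : Type*} [NormedAddCommGroup E] [NormedSpace ℝ E]
  {G : Type*} [TopologicalSpace G] [ChartedSpace E G] [Group G]

theorem invariantTensor_apply {k : ℕ}
    (η : MultilinearMap ℝ (fun _ : Fin k => GroupLieAlgebra 𝓘(ℝ, E) G) ℝ) (x : G)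
    (w : Fin k → TangentSpace 𝓘(ℝ, E) x) :
    invariantTensor η x w = η (fun i => toLieAlgebra x (w i)) := rfl

theorem toLieAlgebra_comp_vecCons {x : G} {k : ℕ} (u : TangentSpace 𝓘(ℝ, E) x)
    (w : Fin k → TangentSpace 𝓘(ℝ, E) x) :
    (fun i => toLieAlgebra x ((Matrix.vecCons u w : Fin (k + 1) → TangentSpace 𝓘(ℝ, E) x) i))
      = Matrix.vecCons (toLieAlgebra x u) (fun i => toLieAlgebra x (w i)) := by
  funext i
  refine Fin.cases rfl (fun i => rfl) i

variable [LieGroup 𝓘(ℝ, E) ∞ G] {ι : Type*}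

/-- The left-invariant frame at a point, from a basis of the Lie algebra. -/
def translatedBasis (e : Module.Basis ι ℝ (GroupLieAlgebra 𝓘(ℝ, E) G)) (x : G) :
    Module.Basis ι ℝ (TangentSpace 𝓘(ℝ, E) x) :=
  e.map (leftTrivialization x).symm

theorem toLieAlgebra_translatedBasis (e : Module.Basis ι ℝ (GroupLieAlgebra 𝓘(ℝ, E) G)) (x : G)
    (i : ι) : toLieAlgebra x (translatedBasis e x i) = e i :=
  toLieAlgebra_mulInvariantVectorField x (e i)

variable [DecidableEq ι]

theorem isOrthonormalBasis_translatedBasis [CompleteSpace E]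
    {e : Module.Basis ι ℝ (GroupLieAlgebra 𝓘(ℝ, E) G)}
    (he : IsOrthonormalBasis (negKilling 𝓘(ℝ, E) G) e) (x : G) :
    IsOrthonormalBasis (killingMetric 𝓘(ℝ, E) G x) (translatedBasis e x) := fun i j => by
  rw [killingMetric_apply, toLieAlgebra_translatedBasis, toLieAlgebra_translatedBasis, he i j]

variable [FiniteDimensional ℝ E] [Fintype ι]

theorem contMDiff_multilinear {k : ℕ} {n : ℕ∞ω}
    {M : Type*} [TopologicalSpace M] [ChartedSpace E M]
    (η : MultilinearMap ℝ (fun _ : Fin k => E) ℝ) {g : Fin k → M → E}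
    (hg : ∀ i, ContMDiff 𝓘(ℝ, E) 𝓘(ℝ, E) n (g i)) :
    ContMDiff 𝓘(ℝ, E) 𝓘(ℝ, ℝ) n (fun y => η (fun i => g i y)) :=
  (toContinuousMultilinear η).contDiff.contMDiff.comp (contMDiff_pi_space.mpr hg)

theorem contMDiff_invariantTensor {k : ℕ}
    (η : MultilinearMap ℝ (fun _ : Fin k => GroupLieAlgebra 𝓘(ℝ, E) G) ℝ)
    {X : Fin k → ∀ x : G, TangentSpace 𝓘(ℝ, E) x}
    (hX : ∀ i, ContMDiff 𝓘(ℝ, E) 𝓘(ℝ, E).tangent ∞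
      (fun x => (X i x : TangentBundle 𝓘(ℝ, E) G))) :
    ContMDiff 𝓘(ℝ, E) 𝓘(ℝ, ℝ) ∞ (fun x => invariantTensor η x (fun i => X i x)) := by
  let ξ : MultilinearMap ℝ (fun _ : Fin k => E) ℝ := η
  exact contMDiff_multilinear ξ fun i x => contMDiffAt_components le_rfl (hX i x)

variable [CompleteSpace E]

theorem contMDiff_killingMetric {X Y : ∀ x : G, TangentSpace 𝓘(ℝ, E) x}
    (hX : ContMDiff 𝓘(ℝ, E) 𝓘(ℝ, E).tangent ∞ (fun x => (X x : TangentBundle 𝓘(ℝ, E) G)))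
    (hY : ContMDiff 𝓘(ℝ, E) 𝓘(ℝ, E).tangent ∞ (fun x => (Y x : TangentBundle 𝓘(ℝ, E) G))) :
    ContMDiff 𝓘(ℝ, E) 𝓘(ℝ, ℝ) ∞ (fun x => killingMetric 𝓘(ℝ, E) G x (X x) (Y x)) := by
  obtain ⟨q, hq⟩ : ∃ q : LinearMap.BilinForm ℝ E, ∀ u v : GroupLieAlgebra 𝓘(ℝ, E) G,
      negKilling 𝓘(ℝ, E) G u v = q u v := ⟨negKilling 𝓘(ℝ, E) G, fun u v => rfl⟩
  have hg : ∀ i, ContMDiff 𝓘(ℝ, E) 𝓘(ℝ, E) ∞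
      ((![components X, components Y] : Fin 2 → G → E) i) :=
    Fin.forall_fin_two.mpr ⟨fun x => contMDiffAt_components le_rfl (hX x),
      fun x => contMDiffAt_components le_rfl (hY x)⟩
  have h := contMDiff_multilinear (bilinMultilinear q) hg
  simp only [bilinMultilinear_apply] at h
  simp only [killingMetric_apply, hq]
  exact h

theorem isMetric_killingMetric (hpos : ∀ u ≠ 0, 0 < negKilling 𝓘(ℝ, E) G u u) :
    IsMetric (killingMetric 𝓘(ℝ, E) G) where
  symm x u v := by rw [killingMetric_apply, killingMetric_apply, negKilling_comm]
  nondegenerate x := by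
    have hposx : ∀ u : TangentSpace 𝓘(ℝ, E) x, killingMetric 𝓘(ℝ, E) G x u u = 0 → u = 0 := by
      intro u hu
      by_contra hne
      rw [killingMetric_apply] at hu
      exact (hpos _ fun h => hne ((leftTrivialization x).map_eq_zero_iff.mp h)).ne' hu
    exact ⟨fun u hu => hposx u (hu u), fun u hu => hposx u (hu u)⟩
  smooth X Y hX hY := contMDiff_killingMetric hX hY

/-- Since `[[p, i], j] = [j, [i, p]]`, the Ricci trace is `-1/4` times the trace of `ad j ∘ ad i`,
that is, `-1/4` times the Killing form. -/
theorem IsLeviCivita.ricci_eq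
    {D : CovariantDerivative 𝓘(ℝ, E) E (TangentSpace 𝓘(ℝ, E) : G → Type _)}
    (hD : IsLeviCivita (killingMetric 𝓘(ℝ, E) G) D)
    (hpos : ∀ u ≠ 0, 0 < negKilling 𝓘(ℝ, E) G u u)
    {e : Module.Basis ι ℝ (GroupLieAlgebra 𝓘(ℝ, E) G)}
    (he : IsOrthonormalBasis (negKilling 𝓘(ℝ, E) G) e) (x : G) (i j : TangentSpace 𝓘(ℝ, E) x) :
    ricci (killingMetric 𝓘(ℝ, E) G) D x i j = (1 / 4) * killingMetric 𝓘(ℝ, E) G x i j := by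
  set b := negKilling 𝓘(ℝ, E) G with hb
  let A : GroupLieAlgebra 𝓘(ℝ, E) G →ₗ[ℝ] GroupLieAlgebra 𝓘(ℝ, E) G :=
    -(1 / 4 : ℝ) • (LieAlgebra.ad ℝ _ (toLieAlgebra x j) ∘ₗ LieAlgebra.ad ℝ _ (toLieAlgebra x i))
  have hA : ∀ p, A p = -(1 / 4 : ℝ) • ⁅⁅p, toLieAlgebra x i⁆, toLieAlgebra x j⁆ := by
    intro p
    rw [← lie_skew ⁅p, toLieAlgebra x i⁆, ← lie_skew p, lie_neg, neg_neg]
    rfl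
  let f : TangentSpace 𝓘(ℝ, E) x →ₗ[ℝ] TangentSpace 𝓘(ℝ, E) x →ₗ[ℝ] ℝ :=
    b.compl₁₂ (A ∘ₗ toLieAlgebra x) (toLieAlgebra x)
  have hf : (fun p q => killingMetric 𝓘(ℝ, E) G x (curvature D x p i j) q) = fun p q => f p q := by
    funext p q
    rw [killingMetric_apply, hD.toLieAlgebra_curvature hpos, ← hA]
    rfl
  have h1 := (isOrthonormalBasis_translatedBasis he x).contract_eq f
  have h2 : ricci (killingMetric 𝓘(ℝ, E) G) D x i j = ∑ p, b (A (e p)) (e p) := by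
    unfold ricci ricciTrace
    rw [hf, h1]
    refine Finset.sum_congr rfl fun p _ => ?_
    change b (A (toLieAlgebra x _)) (toLieAlgebra x _) = _
    rw [toLieAlgebra_translatedBasis]
  have h3 : b (toLieAlgebra x j) (toLieAlgebra x i)
      = - ∑ p, b ⁅toLieAlgebra x j, ⁅toLieAlgebra x i, e p⁆⁆ (e p) :=
    he.neg_killingForm_apply _ _
  rw [h2, killingMetric_apply, negKilling_comm, ← hb, h3, mul_neg, Finset.mul_sum,
    ← Finset.sum_neg_distrib]
  refine Finset.sum_congr rfl fun p _ => ?_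
  have : A (e p) = -(1 / 4 : ℝ) • ⁅toLieAlgebra x j, ⁅toLieAlgebra x i, e p⁆⁆ := rfl
  rw [this, map_smul, LinearMap.smul_apply, smul_eq_mul]
  ring

theorem IsLeviCivita.scalarCurvature_eq
    {D : CovariantDerivative 𝓘(ℝ, E) E (TangentSpace 𝓘(ℝ, E) : G → Type _)}
    (hD : IsLeviCivita (killingMetric 𝓘(ℝ, E) G) D)
    (hpos : ∀ u ≠ 0, 0 < negKilling 𝓘(ℝ, E) G u u)
    {e : Module.Basis ι ℝ (GroupLieAlgebra 𝓘(ℝ, E) G)}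
    (he : IsOrthonormalBasis (negKilling 𝓘(ℝ, E) G) e) (x : G) :
    scalarCurvature (killingMetric 𝓘(ℝ, E) G) D x = (1 / 4) * Fintype.card ι := by
  have hex := isOrthonormalBasis_translatedBasis he x
  have h1 : ricci (killingMetric 𝓘(ℝ, E) G) D x
      = fun u v => ((1 / 4 : ℝ) • killingMetric 𝓘(ℝ, E) G x) u v := by
    funext u v
    rw [hD.ricci_eq hpos he]
    rfl
  unfold scalarCurvature
  rw [h1, hex.contract_eq]
  simp [hex _ _, mul_comm]

theorem isTraceFreeSymmetricTensor_invariantTensor {m : ℕ}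
    {η : MultilinearMap ℝ (fun _ : Fin (m + 2) => GroupLieAlgebra 𝓘(ℝ, E) G) ℝ}
    {e : Module.Basis ι ℝ (GroupLieAlgebra 𝓘(ℝ, E) G)}
    (he : IsOrthonormalBasis (negKilling 𝓘(ℝ, E) G) e)
    (hη : ∀ (s : Equiv.Perm (Fin (m + 2))) (w : Fin (m + 2) → GroupLieAlgebra 𝓘(ℝ, E) G),
      η (fun i => w (s i)) = η w)
    (htr : ∀ w, ∑ a, η (Matrix.vecCons (e a) (Matrix.vecCons (e a) w)) = 0) :
    IsTraceFreeSymmetricTensor (killingMetric 𝓘(ℝ, E) G)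
      (invariantTensor (I := 𝓘(ℝ, E)) (G := G) η) where
  symm x s w := hη s fun i => toLieAlgebra x (w i)
  traceFree x w := by
    have h1 := (isOrthonormalBasis_translatedBasis he x).contract_eq
      (firstTwo (invariantTensor η x) w)
    refine h1.trans (Eq.trans (Finset.sum_congr rfl fun a _ => ?_)
      (htr fun i => toLieAlgebra x (w i)))
    rw [firstTwo_apply, invariantTensor_apply, toLieAlgebra_comp_vecCons,
      toLieAlgebra_comp_vecCons, toLieAlgebra_translatedBasis]
  smooth X hX := contMDiff_invariantTensor η hX

end Geometry

/-! ### The coupled Einstein equations -/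

section Einstein

variable {E : Type*} [NormedAddCommGroup E] [NormedSpace ℝ E] [FiniteDimensional ℝ E]
  [CompleteSpace E]
  {G : Type*} [TopologicalSpace G] [ChartedSpace E G] [Group G] [LieGroup 𝓘(ℝ, E) ∞ G]
  {ι : Type*} [Fintype ι] [DecidableEq ι]

theorem ricciContraction_invariantTensor {m : ℕ}
    {e : Module.Basis ι ℝ (GroupLieAlgebra 𝓘(ℝ, E) G)}
    (he : IsOrthonormalBasis (negKilling 𝓘(ℝ, E) G) e)
    (η : MultilinearMap ℝ (fun _ : Fin (m + 1) => GroupLieAlgebra 𝓘(ℝ, E) G) ℝ) (x : G)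
    (i j : TangentSpace 𝓘(ℝ, E) x) :
    ricciContraction (killingMetric 𝓘(ℝ, E) G x) (invariantTensor η x) (invariantTensor η x) i j
      = ricciForm e η (toLieAlgebra x i) (toLieAlgebra x j) := by
  rw [(isOrthonormalBasis_translatedBasis he x).ricciContraction_eq]
  refine Finset.sum_congr rfl fun p _ => ?_
  rw [invariantTensor_apply, invariantTensor_apply, toLieAlgebra_comp_vecCons,
    toLieAlgebra_comp_vecCons]
  simp only [toLieAlgebra_translatedBasis]
  rfl

/-- The contraction at every point is the left translate of one form on the Lie algebra, so a single
`c` serves the whole group. -/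
theorem exists_ricciContraction_eq [LieAlgebra.IsSimple ℝ (GroupLieAlgebra 𝓘(ℝ, E) G)] [Nonempty ι]
    {m : ℕ} {e : Module.Basis ι ℝ (GroupLieAlgebra 𝓘(ℝ, E) G)}
    (he : IsOrthonormalBasis (negKilling 𝓘(ℝ, E) G) e)
    {η : MultilinearMap ℝ (fun _ : Fin (m + 1) => GroupLieAlgebra 𝓘(ℝ, E) G) ℝ}
    (hη : ∀ (x : GroupLieAlgebra 𝓘(ℝ, E) G) (w : Fin (m + 1) → GroupLieAlgebra 𝓘(ℝ, E) G),
      ∑ s, η (Function.update w s ⁅x, w s⁆) = 0) :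
    ∃ c : ℝ, ∀ (x : G) (i j : TangentSpace 𝓘(ℝ, E) x),
      ricciContraction (killingMetric 𝓘(ℝ, E) G x) (invariantTensor η x) (invariantTensor η x) i j
        = c * killingMetric 𝓘(ℝ, E) G x i j := by
  obtain ⟨c, hc⟩ := he.exists_eq_mul isAdInvariant_negKilling
    (fun u v => Finset.sum_congr rfl fun p _ => mul_comm _ _)
    (he.isAdInvariant_ricciForm isAdInvariant_negKilling hη)
  exact ⟨c, fun x i j => by
    rw [ricciContraction_invariantTensor he, hc, killingMetric_apply]⟩

theorem normSq_invariantTensor {m : ℕ} {e : Module.Basis ι ℝ (GroupLieAlgebra 𝓘(ℝ, E) G)}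
    (he : IsOrthonormalBasis (negKilling 𝓘(ℝ, E) G) e)
    {η : MultilinearMap ℝ (fun _ : Fin (m + 1) => GroupLieAlgebra 𝓘(ℝ, E) G) ℝ} {c : ℝ} {x : G}
    (hc : ∀ i j : TangentSpace 𝓘(ℝ, E) x, ricciContraction (killingMetric 𝓘(ℝ, E) G x)
      (invariantTensor η x) (invariantTensor η x) i j = c * killingMetric 𝓘(ℝ, E) G x i j) :
    normSq (killingMetric 𝓘(ℝ, E) G x) (invariantTensor η x) = Fintype.card ι * c := by
  have hex := isOrthonormalBasis_translatedBasis he x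
  rw [hex.normSq_eq]
  simp [hc, hex _ _]

theorem codazziForm_zero {V : Type*} [AddCommGroup V] [Module ℝ V] [Module.Finite ℝ V]
    (h : LinearMap.BilinForm ℝ V) {m : ℕ} (η : (Fin (m + 1) → V) → ℝ) (i : V) :
    codazziForm h η (fun _ _ => 0) i = 0 := by
  simp [codazziForm, codazziPart, pairing, divergence, contract, ins]

theorem conformalKillingForm_zero {V : Type*} [AddCommGroup V] [Module ℝ V] [Module.Finite ℝ V]
    (h : LinearMap.BilinForm ℝ V) {m : ℕ} (η : (Fin (m + 1) → V) → ℝ) (i : V) :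
    conformalKillingForm h η (fun _ _ => 0) i = 0 := by
  simp [conformalKillingForm, killingPart, pairing, divergence, contract, ins, symmetrize]

theorem divergenceForm_zero {V : Type*} [AddCommGroup V] [Module ℝ V] [Module.Finite ℝ V]
    (h : LinearMap.BilinForm ℝ V) {m : ℕ} (η : (Fin (m + 1) → V) → ℝ) (i : V) :
    divergenceForm h η (fun _ _ => 0) i = 0 := by
  simp [divergenceForm, pairing, divergence, contract, ins]

end Einstein

end CoupledEinstein

end

/-! ### The main theorem -/

theorem mainTheorem5
    {E : Type*} [NormedAddCommGroup E] [NormedSpace ℝ E] [FiniteDimensional ℝ E] [CompleteSpace E]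
    {G : Type*} [TopologicalSpace G] [ChartedSpace E G] [Group G] [LieGroup 𝓘(ℝ, E) ∞ G]
    [T2Space G] [CompactSpace G] [ConnectedSpace G]
    [LieAlgebra.IsSimple ℝ (GroupLieAlgebra 𝓘(ℝ, E) G)]
    (hdim : 3 < Module.finrank ℝ E)
    -- the degree is `m + 3`, that is, any `k ≥ 3`
    (m : ℕ) (P : GroupLieAlgebra 𝓘(ℝ, E) G → ℝ)
    (η : MultilinearMap ℝ (fun _ : Fin (m + 3) => GroupLieAlgebra 𝓘(ℝ, E) G) ℝ)
    (hη : CoupledEinstein.IsPolarization η P)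
    (hinv : ∀ (g : G) (v : GroupLieAlgebra 𝓘(ℝ, E) G),
      P (CoupledEinstein.adjointAction g v) = P v)
    (hharm : ∀ v, CoupledEinstein.laplacian (CoupledEinstein.negKilling 𝓘(ℝ, E) G) P v = 0)
    (D : CovariantDerivative 𝓘(ℝ, E) E (TangentSpace 𝓘(ℝ, E) : G → Type _))
    (hD : CoupledEinstein.IsLeviCivita (CoupledEinstein.killingMetric 𝓘(ℝ, E) G) D) :
    (∀ a b : ℝ, CoupledEinstein.SolvesCoupledEinstein
      (CoupledEinstein.killingMetric 𝓘(ℝ, E) G) D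
      (CoupledEinstein.invariantTensor (I := 𝓘(ℝ, E)) (G := G) η) a b) ∧
    (∀ (x : G) (v : TangentSpace 𝓘(ℝ, E) x) (w : Fin (m + 3) → TangentSpace 𝓘(ℝ, E) x),
      CoupledEinstein.covDeriv D
        (CoupledEinstein.invariantTensor (I := 𝓘(ℝ, E)) (G := G) η) x v w = 0) ∧
    (∃ c : ℝ, ∀ (x : G),
      c = CoupledEinstein.normSq (CoupledEinstein.killingMetric 𝓘(ℝ, E) G x)
          (CoupledEinstein.invariantTensor η x) / (Module.finrank ℝ E : ℝ) ∧
      ∀ i j : TangentSpace 𝓘(ℝ, E) x,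
        CoupledEinstein.ricciContraction (CoupledEinstein.killingMetric 𝓘(ℝ, E) G x)
          (CoupledEinstein.invariantTensor η x) (CoupledEinstein.invariantTensor η x) i j
            = c * CoupledEinstein.killingMetric 𝓘(ℝ, E) G x i j) := by
  have hpos : ∀ u ≠ 0, 0 < CoupledEinstein.negKilling 𝓘(ℝ, E) G u u := fun u hu =>
    CoupledEinstein.negKilling_pos hu
  have hlie := CoupledEinstein.sum_map_update_lie hη hinv
  have hpar := hD.covDeriv_invariantTensor hpos hlie
  have : Module.Finite ℝ (GroupLieAlgebra 𝓘(ℝ, E) G) := inferInstanceAs (Module.Finite ℝ E)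
  obtain ⟨e, he⟩ := CoupledEinstein.exists_isOrthonormalBasis
    (CoupledEinstein.negKilling_comm (E := E) (G := G)) hpos
  have hcard : Fintype.card (Fin (Module.finrank ℝ (GroupLieAlgebra 𝓘(ℝ, E) G)))
      = Module.finrank ℝ E := Fintype.card_fin _
  have : Nonempty (Fin (Module.finrank ℝ (GroupLieAlgebra 𝓘(ℝ, E) G))) :=
    Fintype.card_pos_iff.mp (by omega)
  obtain ⟨c, hc⟩ := CoupledEinstein.exists_ricciContraction_eq he hlie
  have hnorm := fun x => CoupledEinstein.normSq_invariantTensor he (hc x)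
  have htrace := CoupledEinstein.trace_eq_zero_of_harmonic he hη hharm
  have htf := CoupledEinstein.isTraceFreeSymmetricTensor_invariantTensor he hη.symm htrace
  have hric : ∀ (x : G) (i j : TangentSpace 𝓘(ℝ, E) x), CoupledEinstein.ricciTrace
      (CoupledEinstein.killingMetric 𝓘(ℝ, E) G x)
      (CoupledEinstein.kulkarniNomizu (CoupledEinstein.killingMetric 𝓘(ℝ, E) G x)
        (CoupledEinstein.invariantTensor η x) (CoupledEinstein.invariantTensor η x)) i j
      = c * CoupledEinstein.killingMetric 𝓘(ℝ, E) G x i j := fun x i j => by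
    have hex := CoupledEinstein.isOrthonormalBasis_translatedBasis he x
    rw [← hc, hex.ricciTrace_kulkarniNomizu (htf.symm x) fun w => ?_]
    exact (hex.contract_eq (CoupledEinstein.firstTwo
      (CoupledEinstein.invariantTensor η x) w)).symm.trans (htf.traceFree x w)
  have hn : (3 : ℝ) < Module.finrank ℝ E := by exact_mod_cast hdim
  simp only [hcard] at hnorm
  refine ⟨fun a b => ?_, hpar, c, fun x => ⟨?_, hc x⟩⟩
  · have hcov : ∀ x, CoupledEinstein.covDeriv D
        (CoupledEinstein.invariantTensor (I := 𝓘(ℝ, E)) (G := G) η) x = fun _ _ => 0 := fun x =>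
      funext fun v => funext fun w => hpar x v w
    refine ⟨CoupledEinstein.isMetric_killingMetric hpos, htf, fun x i => ?_, fun x i => ?_,
      fun x i => ?_, ?_⟩
    · rw [hcov, CoupledEinstein.codazziForm_zero]
    · rw [hcov, CoupledEinstein.conformalKillingForm_zero]
    · rw [hcov, CoupledEinstein.divergenceForm_zero]
    · set n : ℝ := (Module.finrank ℝ E : ℝ)
      -- All terms are multiples of `h`: `Ric = h/4`, `R = n/4`, `Ric(ω ∧ ω) = c h`, `|ω|² = n c`.
      -- The witness solves the resulting scalar equation for `κ`, dividing by `(n - 2)/(2n)`, which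
      -- is nonzero as `n > 3`. The rank enters as `(m + 1) + 2`.
      refine ⟨(a * (c - 1 / 2 * (n * c)) + b * (c + 1 / (2 * ((m + 1 + 2 : ℕ) : ℝ)) * (n * c))
        - 1 / 4 + 1 / 2 * (1 / 4 * n)) * (2 * n) / (n - 2), fun x i j => ?_⟩
      rw [hD.ricci_eq hpos he, hD.scalarCurvature_eq hpos he, hcard]
      unfold CoupledEinstein.stressPlus CoupledEinstein.stressMinus
      rw [hric, hnorm]
      have h2 : n - 2 ≠ 0 := by linarith
      have h3 : n ≠ 0 := by linarith
      field_simp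
      ring
  · rw [hnorm, mul_div_cancel_left₀ _ (by linarith)]
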